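/- Let $n_l\ge 0$ and consider the interconnection of a first-order reset element with state $x_r\in\mathbb R$, base dynamics $\dot x_r=A_rx_r+B_ru_1$, $u_r=C_rx_r+D_ru_1$ (with $A_r,B_r,C_r,D_r\in\mathbb R$) and after-reset value $\gamma\in\mathbb R$, with the linear system $$\dot x_l=Ax_l+B_uu_r+Bw,\quad y=Cx_l,\quad u_1=C_ux_l+D_uw,\quad e_r=C_ex_l+D_ew,\qquad x_l\in\mathbb R^{n_l},\ w\in\mathbb R^2,$$ where $y,u_1,e_r,u_r$ are scalar. The resulting reset control system with state $x=(x_r,x_l)\in\mathbb R^{1+n_l}$ is $$\dot x(t)=\bar Ax(t)+\bar Bw(t)\ \text{ if } x(t)\notin\mathcal F,\qquad x(t^+)=A_\rho x(t)\ \text{ if } x(t)\in\mathcal F,$$ $$\bar A=\begin{bmatrix}A_r&B_rC_u\\B_uC_r&A+B_uD_rC_u\end{bmatrix},\quad \bar B=\begin{bmatrix}B_rD_u\\B+B_uD_rD_u\end{bmatrix},\quad A_\rho=\begin{bmatrix}\gamma&0\\0&I\end{bmatrix},$$ with reset surface $\mathcal F=\{x:\ [0\ \ C_e]x+D_ew(t)=0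 \text{ and } (I-A_\rho)x\ne 0\}$. A solution on $[t_0,T)$, $T\le\infty$, is a left-continuous function $x$ on $[t_0,T)$ such that, at every $t\in[t_0,T)$, if $x(t)\notin\mathcal F$ then the right derivative of $x$ at $t$ is $\bar Ax(t)+\bar Bw(t)$, and if $x(t)\in\mathcal F$ then $x(t^+)=A_\rho x(t)$. Suppose that there exist $\varrho>0$ and $\beta\in\mathbb R$ such that, with $C_0=[\varrho\ \ \beta C_e]$ and $B_0=\begin{bmatrix}1\\0_{n_l\times1}\end{bmatrix}$, 1. the transfer function $H_\beta(s)=C_0(sI-\bar A)^{-1}B_0$ is strictly positive real, i.e. for some $\varepsilon>0$ the rational function $H_\beta$ has no poles in $\operatorname{Re}s>-\varepsilon$ and $\operatorname{Re}H_\beta(s)\ge0$ there; 2. $(\bar A,B_0)$ is controllable and $(\bar A,C_0)$ is observable; and that $-1\le\gamma\le1$. Then the zero equilibrium of the reset control system with $w=0$ is globally uniformly asymptotically stable: the zero function is a solution, and - for every $\varepsilon>0$ there is $\delta>0$ such that every solution with $\|x(t_0)\|<\delta$ satisfies $\|x(t)\|<\varepsilon$ for all $t\ge t_0$ at which it exists;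 - for every $r>0$ there is $R>0$ such that every solution with $\|x(t_0)\|<r$ satisfies $\|x(t)\|<R$ for all $t\ge t_0$ at which it exists; - for all $r,\varepsilon>0$ there is $\tau>0$ such that every solution with $\|x(t_0)\|<r$ satisfies $\|x(t)\|<\varepsilon$ for all $t\ge t_0+\tau$ at which it exists; where $\delta,R,\tau$ depend neither on $t_0$ nor on the solution. -/

import Mathlib

open Filter Topology

noncomputable section

namespace ResetControl

/-! ### Linear systems: controllability, observability, transfer functions -/

/-- The pair `(A, B)` is controllable: the controllability matrix
`[B, A B, …, A ^ (N - 1) B]` has full rank `N`, where `N` is the state dimension. -/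
def IsControllable {ι m : Type*} [Fintype ι] [DecidableEq ι] [Fintype m]
    (A : Matrix ι ι ℝ) (B : Matrix ι m ℝ) : Prop :=
  (Matrix.of fun (i : ι) (p : Fin (Fintype.card ι) × m) => (A ^ (p.1 : ℕ) * B) i p.2).rank
    = Fintype.card ι

/-- The pair `(A, C)` is observable: the observability matrix with block rows
`C, C A, …, C A ^ (N - 1)` has full rank `N`, where `N` is the state dimension. -/
def IsObservable {ι p : Type*} [Fintype ι] [DecidableEq ι] [Fintype p]
    (A : Matrix ι ι ℝ) (C : Matrix p ι ℝ) : Prop :=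
  (Matrix.of fun (q : Fin (Fintype.card ι) × p) (i : ι) => (C * A ^ (q.1 : ℕ)) q.2 i).rank
    = Fintype.card ι

/-- The transfer function `C (s I - A)⁻¹ B` of a single-input single-output system, as a rational
function of `s`. The matrix `s I - A` is invertible over the field of rational functions, so the
inverse is a genuine one. -/
def transferFunction {ι : Type*} [Fintype ι] [DecidableEq ι]
    (A : Matrix ι ι ℝ) (B : Matrix ι (Fin 1) ℝ) (C : Matrix (Fin 1) ι ℝ) : RatFunc ℝ :=
  (C.map (RatFunc.C : ℝ →+* RatFunc ℝ)
    * ((RatFunc.X : RatFunc ℝ) • (1 : Matrix ι ι (RatFunc ℝ))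
        - A.map (RatFunc.C : ℝ →+* RatFunc ℝ))⁻¹
    * B.map (RatFunc.C : ℝ →+* RatFunc ℝ)) 0 0

/-- `s ↦ H (s - ε)` is positive real: it has no pole in the open right half-plane, and its real
part is nonnegative there. (The shift is written out: `s - ε` ranges over `Re s > -ε`. The
denominator `H.denom` is the one in lowest terms, so its zeros are the poles.) -/
def IsPositiveRealShift (H : RatFunc ℝ) (ε : ℝ) : Prop :=
  ∀ s : ℂ, -ε < s.re →
    Polynomial.aeval s H.denom ≠ 0 ∧ 0 ≤ (RatFunc.eval (algebraMap ℝ ℂ) s H).re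

/-- `H` is strictly positive real: `s ↦ H (s - ε)` is positive real for some `ε > 0`. -/
def IsStrictlyPositiveReal (H : RatFunc ℝ) : Prop :=
  ∃ ε : ℝ, 0 < ε ∧ IsPositiveRealShift H ε

/-! ### The reset control system -/

/-- The state space `ℝ^(1 + n)`: the state `x_r` of the reset element, followed by the state `x_l`
of the linear part. -/
abbrev State (n : ℕ) : Type := Fin 1 ⊕ Fin n → ℝ

/-- The data of a reset control system. The first-order reset element has base dynamics
`x_r' = A_r x_r + B_r u_1`, `u_r = C_r x_r + D_r u_1` and after-reset value `γ`; the linear part is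
`x_l' = A x_l + B_u u_r + B w`, `y = C x_l`, `u_1 = C_u x_l + D_u w`, `e_r = C_e x_l + D_e w`. -/
structure ResetSystem (n : ℕ) where
  Ar : ℝ
  Br : ℝ
  Cr : ℝ
  Dr : ℝ
  γ : ℝ
  A : Matrix (Fin n) (Fin n) ℝ
  B : Matrix (Fin n) (Fin 2) ℝ
  Bu : Matrix (Fin n) (Fin 1) ℝ
  C : Matrix (Fin 1) (Fin n) ℝ
  Cu : Matrix (Fin 1) (Fin n) ℝ
  Du : Matrix (Fin 1) (Fin 2) ℝ
  Ce : Matrix (Fin 1) (Fin n) ℝ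
  De : Matrix (Fin 1) (Fin 2) ℝ

namespace ResetSystem

variable {n : ℕ} (S : ResetSystem n)

/-- A real number as a `1 × 1` matrix. -/
def scalar (a : ℝ) : Matrix (Fin 1) (Fin 1) ℝ := Matrix.of fun _ _ => a

/-- The closed-loop matrix `[A_r, B_r C_u; B_u C_r, A + B_u D_r C_u]`. -/
def Abar : Matrix (Fin 1 ⊕ Fin n) (Fin 1 ⊕ Fin n) ℝ :=
  Matrix.fromBlocks (scalar S.Ar) (S.Br • S.Cu) (S.Cr • S.Bu) (S.A + S.Dr • (S.Bu * S.Cu))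

/-- The closed-loop input matrix `[B_r D_u; B + B_u D_r D_u]`. -/
def Bbar : Matrix (Fin 1 ⊕ Fin n) (Fin 2) ℝ :=
  Matrix.fromRows (S.Br • S.Du) (S.B + S.Dr • (S.Bu * S.Du))

/-- The matrix `[0, C_e]`, so that `e_r = [0, C_e] x + D_e w`. -/
def CeBar : Matrix (Fin 1) (Fin 1 ⊕ Fin n) ℝ :=
  Matrix.fromCols 0 S.Ce

/-- The reset matrix `diag(γ, I)`. -/
def Arho : Matrix (Fin 1 ⊕ Fin n) (Fin 1 ⊕ Fin n) ℝ :=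
  Matrix.fromBlocks (scalar S.γ) 0 0 1

/-- The reset surface for the current input value `v = w(t)`: the states with `e_r = 0` that the
reset would change. -/
def resetSurface (v : Fin 2 → ℝ) : Set (State n) :=
  {x | S.CeBar.mulVec x + S.De.mulVec v = 0 ∧ (1 - S.Arho).mulVec x ≠ 0}

/-- `x` is a (left-continuous) solution on `[t₀, T)`, `T ≤ ∞`, with continuous input `w`:
it flows along `x' = Ā x + B̄ w` when it is off the reset surface and jumps, `x(t⁺) = A_ρ x(t)`,
when it is on the reset surface. Since the jump takes place immediately after time `t`, the flow
equation is the one for the right derivative; between resets it is the ordinary differential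
equation. No restriction is put on the number or the spacing of the resets. -/
structure IsSolution (w : ℝ → Fin 2 → ℝ) (t₀ : ℝ) (T : EReal) (x : ℝ → State n) : Prop where
  left_continuous : ∀ t : ℝ, t₀ < t → (t : EReal) < T → ContinuousWithinAt x (Set.Iic t) t
  flow : ∀ t : ℝ, t₀ ≤ t → (t : EReal) < T → x t ∉ S.resetSurface (w t) →
    HasDerivWithinAt x (S.Abar.mulVec (x t) + S.Bbar.mulVec (w t)) (Set.Ici t) t
  jump : ∀ t : ℝ, t₀ ≤ t → (t : EReal) < T → x t ∈ S.resetSurface (w t) →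
    Tendsto x (𝓝[>] t) (𝓝 (S.Arho.mulVec (x t)))

/-- The zero equilibrium of the system with input `w = 0` is globally uniformly asymptotically
stable: zero is an equilibrium, and all solutions, for as long as they exist, are uniformly stable,
uniformly bounded and uniformly convergent to zero, uniformly in the initial time and in initial
states of bounded norm. (These properties do not depend on the choice of the norm.) -/
structure IsGloballyUniformlyAsymptoticallyStable : Prop where
  equilibrium : ∀ t₀ : ℝ, S.IsSolution 0 t₀ ⊤ (fun _ => 0)
  uniformly_stable : ∀ ε : ℝ, 0 < ε → ∃ δ : ℝ, 0 < δ ∧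
    ∀ (t₀ : ℝ) (T : EReal) (x : ℝ → State n), S.IsSolution 0 t₀ T x → ‖x t₀‖ < δ →
      ∀ t : ℝ, t₀ ≤ t → (t : EReal) < T → ‖x t‖ < ε
  uniformly_bounded : ∀ r : ℝ, 0 < r → ∃ R : ℝ, 0 < R ∧
    ∀ (t₀ : ℝ) (T : EReal) (x : ℝ → State n), S.IsSolution 0 t₀ T x → ‖x t₀‖ < r →
      ∀ t : ℝ, t₀ ≤ t → (t : EReal) < T → ‖x t‖ < R
  uniformly_attractive : ∀ r : ℝ, 0 < r → ∀ ε : ℝ, 0 < ε → ∃ τ : ℝ, 0 < τ ∧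
    ∀ (t₀ : ℝ) (T : EReal) (x : ℝ → State n), S.IsSolution 0 t₀ T x → ‖x t₀‖ < r →
      ∀ t : ℝ, t₀ + τ ≤ t → (t : EReal) < T → ‖x t‖ < ε

/-- The column `B₀ = [1; 0]`. -/
def B0 (n : ℕ) : Matrix (Fin 1 ⊕ Fin n) (Fin 1) ℝ :=
  Matrix.fromRows 1 0

/-- The row `C₀ = [ϱ, β C_e]`. -/
def C0 (ϱ β : ℝ) : Matrix (Fin 1) (Fin 1 ⊕ Fin n) ℝ :=
  Matrix.fromCols (scalar ϱ) (β • S.Ce)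

/-- The transfer function `H_β(s) = C₀ (s I - Ā)⁻¹ B₀`. -/
def Hbeta (ϱ β : ℝ) : RatFunc ℝ :=
  transferFunction S.Abar (B0 n) (S.C0 ϱ β)

end ResetSystem

end ResetControl

end

/-! The Lyapunov function is V(x) = xᵀPx, with P supplied by the Kalman–Yakubovich–Popov lemma
(`IsStrictlyPositiveReal.exists_posDef`): P > 0, PB₀ = C₀ᵀ and xᵀPĀx ≤ -aV(x) for some a > 0. Along
the flow V' ≤ -2aV. A reset adds (γ - 1)x_r B₀ to the state, and C₀x = ϱx_r on the reset surface, so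
V changes by ϱ(γ² - 1)x_r² ≤ 0. Hence exp(2at)V(x(t)) never increases, however the resets
accumulate, and comparing V with the squared norm gives an exponential bound uniform in t₀
(`exists_exponential_bound`).

The matrix P is built algebraically. Write the transfer function as q/p with p the characteristic
polynomial; minimality makes every root of p a pole (`charpoly_dvd_denom_pow`), so p has its roots
to the left of the imaginary axis, with a margin. Shifting A by half the margin reduces the claim to
`exists_posDef_of_positiveReal`. There a spectral factor r with q(s)p(-s) + q(-s)p(s) = r(s)r(-s) is
realized as the numerator for an output row l, P solves AᵀP + PA = -llᵀ, and Pb = c follows from the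
coprimality of p(s) and p(-s). -/

noncomputable section

namespace ResetControl

open Matrix Polynomial

/-! ### Resolvent numerators as polynomials -/

section Resolvent

variable {ι R : Type*} [Fintype ι] [DecidableEq ι] [CommRing R]

/-- The polynomial vector `adj (X - A) v`. -/
def adjVec (A : Matrix ι ι R) (v : ι → R) : ι → R[X] :=
  (charmatrix A).adjugate *ᵥ fun i => C (v i)

/-- The numerator `w adj (X - A) v` of the transfer function `w (X - A)⁻¹ v`. -/
def resNum (A : Matrix ι ι R) (w v : ι → R) : R[X] :=
  (fun i => C (w i)) ⬝ᵥ adjVec A v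

theorem charmatrix_mulVec_C (A : Matrix ι ι R) (v : ι → R) :
    charmatrix A *ᵥ (fun i => C (v i)) = fun i => X * C (v i) - C ((A *ᵥ v) i) := by
  ext1 i
  simp [charmatrix, mulVec, dotProduct, diagonal_apply, sub_mul, ite_mul, Finset.sum_sub_distrib,
    mul_comm X]

/-- This is adj(X - A)(X - A)v = pv, with p the characteristic polynomial; multiplying in the other
order gives `mulVec_adjVec`. -/
theorem adjVec_mulVec (A : Matrix ι ι R) (v : ι → R) (i : ι) :
    adjVec A (A *ᵥ v) i = X * adjVec A v i - A.charpoly * C (v i) := by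
  have h : (charmatrix A).adjugate *ᵥ (charmatrix A *ᵥ fun i => C (v i))
      = A.charpoly • fun i => C (v i) := by
    rw [mulVec_mulVec, adjugate_mul, smul_mulVec, one_mulVec]; rfl
  have h2 := congrFun h i
  rw [charmatrix_mulVec_C] at h2
  have h3 : (fun i => X * C (v i) - C ((A *ᵥ v) i))
      = (X : R[X]) • (fun i => C (v i)) - fun i => C ((A *ᵥ v) i) := rfl
  rw [h3, mulVec_sub, mulVec_smul] at h2
  simp only [Pi.sub_apply, Pi.smul_apply, smul_eq_mul] at h2
  simp only [adjVec]
  linear_combination -h2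

theorem mulVec_adjVec (A : Matrix ι ι R) (v : ι → R) (i : ι) :
    (A.map C *ᵥ adjVec A v) i = X * adjVec A v i - A.charpoly * C (v i) := by
  have h : charmatrix A *ᵥ ((charmatrix A).adjugate *ᵥ fun i => C (v i))
      = A.charpoly • fun i => C (v i) := by
    rw [mulVec_mulVec, mul_adjugate, smul_mulVec, one_mulVec]; rfl
  have h2 := congrFun h i
  have h3 : charmatrix A = (X : R[X]) • (1 : Matrix ι ι R[X]) - A.map C := by
    ext1 k l
    simp [charmatrix_apply, diagonal_apply, one_apply]
  nth_rw 1 [h3] at h2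
  rw [sub_mulVec, smul_mulVec, one_mulVec] at h2
  simp only [Pi.sub_apply, Pi.smul_apply, smul_eq_mul] at h2
  simp only [adjVec]
  linear_combination -h2

theorem resNum_mulVec (A : Matrix ι ι R) (w v : ι → R) :
    resNum A w (A *ᵥ v) = X * resNum A w v - A.charpoly * C (w ⬝ᵥ v) := by
  simp only [resNum, dotProduct, adjVec_mulVec, map_sum, Finset.mul_sum, map_mul,
    ← Finset.sum_sub_distrib]
  exact Finset.sum_congr rfl fun i _ => by ring

theorem resNum_vecMul (A : Matrix ι ι R) (w v : ι → R) :
    resNum A (w ᵥ* A) v = X * resNum A w v - A.charpoly * C (w ⬝ᵥ v) := by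
  have h : resNum A (w ᵥ* A) v = (fun i => C (w i)) ⬝ᵥ (A.map C *ᵥ adjVec A v) := by
    rw [dotProduct_mulVec, resNum]
    congr 1
    ext1 i
    simp [vecMul, dotProduct]
  rw [h]
  simp only [resNum, dotProduct, mulVec_adjVec, map_sum, Finset.mul_sum, map_mul,
    ← Finset.sum_sub_distrib]
  exact Finset.sum_congr rfl fun i _ => by ring

theorem resNum_eq_sum (A : Matrix ι ι R) (w v : ι → R) :
    resNum A w v = ∑ i, ∑ j, C (w i) * ((charmatrix A).adjugate i j * C (v j)) := by
  simp [resNum, adjVec, mulVec, dotProduct, Finset.mul_sum]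

theorem resNum_add_left (A : Matrix ι ι R) (w w' v : ι → R) :
    resNum A (w + w') v = resNum A w v + resNum A w' v := by
  simp [resNum, dotProduct, add_mul, Finset.sum_add_distrib]

theorem resNum_smul_left (A : Matrix ι ι R) (a : R) (w v : ι → R) :
    resNum A (a • w) v = a • resNum A w v := by
  simp [resNum, dotProduct, Finset.smul_sum, smul_eq_C_mul, mul_assoc]

theorem resNum_sub_left (A : Matrix ι ι R) (w w' v : ι → R) :
    resNum A (w - w') v = resNum A w v - resNum A w' v := by
  simp [resNum, dotProduct, sub_mul]

/-- `resNum` as a linear map in its first vector. -/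
def resNumLeft (A : Matrix ι ι R) (v : ι → R) : (ι → R) →ₗ[R] R[X] where
  toFun w := resNum A w v
  map_add' w w' := resNum_add_left A w w' v
  map_smul' a w := resNum_smul_left A a w v

theorem resNum_transpose (A : Matrix ι ι R) (w v : ι → R) :
    resNum Aᵀ v w = resNum A w v := by
  rw [resNum_eq_sum, resNum_eq_sum, Finset.sum_comm]
  refine Finset.sum_congr rfl fun i _ => Finset.sum_congr rfl fun j _ => ?_
  rw [charmatrix_transpose, ← adjugate_transpose, transpose_apply]
  ring

theorem resNum_single (A : Matrix ι ι R) (i j : ι) :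
    resNum A (Pi.single i 1) (Pi.single j 1) = (charmatrix A).adjugate i j := by
  rw [resNum_eq_sum]
  simp [Pi.single_apply, apply_ite C, ite_mul, mul_ite]

theorem eval_resNum (A : Matrix ι ι R) (w v : ι → R) (s : R) :
    (resNum A w v).eval s = w ⬝ᵥ fun i => (adjVec A v i).eval s := by
  simp [resNum, dotProduct, eval_finsetSum]

theorem mulVec_eval_adjVec (A : Matrix ι ι R) (v : ι → R) (s : R) :
    A *ᵥ (fun i => (adjVec A v i).eval s)
      = s • (fun i => (adjVec A v i).eval s) - A.charpoly.eval s • v := by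
  ext i
  have h := congrArg (eval s) (mulVec_adjVec A v i)
  simpa [mulVec, dotProduct, eval_finsetSum] using h

theorem degree_adjugate_charmatrix_lt [Nontrivial R] (A : Matrix ι ι R) (i j : ι) :
    ((charmatrix A).adjugate i j).degree < Fintype.card ι := by
  -- The cofactor is the determinant of XA' + B'. Row j of A' is zero, so det A', the coefficient of
  -- X^N, vanishes.
  set A' : Matrix ι ι R := (1 : Matrix ι ι R).updateRow j 0
  set B' : Matrix ι ι R := (-A).updateRow j (Pi.single i 1)
  have h : (charmatrix A).updateRow j (Pi.single i 1)
      = (X : R[X]) • A'.map C + B'.map C := by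
    ext1 k l
    by_cases hk : k = j
    · subst hk
      simp [A', B', Pi.single_apply, apply_ite C]
    · simp [A', B', hk, charmatrix_apply, one_apply, diagonal_apply, sub_eq_add_neg,
        apply_ite C]
  rw [adjugate_apply, h, degree_lt_iff_coeff_zero]
  intro m hm
  rcases hm.eq_or_lt with rfl | hm
  · rw [coeff_det_X_add_C_card]
    exact det_eq_zero_of_row_eq_zero j fun l => by simp [A']
  · exact coeff_eq_zero_of_natDegree_lt ((natDegree_det_X_add_C_le A' B').trans_lt hm)

theorem degree_resNum_lt [Nontrivial R] (A : Matrix ι ι R) (w v : ι → R) :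
    (resNum A w v).degree < Fintype.card ι := by
  rw [resNum_eq_sum, ← mem_degreeLT]
  refine Submodule.sum_mem _ fun i _ => Submodule.sum_mem _ fun j _ => ?_
  rw [mul_comm _ (C (v j)), ← mul_assoc, ← C_mul, ← smul_eq_C_mul]
  exact Submodule.smul_mem _ _ (mem_degreeLT.2 (degree_adjugate_charmatrix_lt A i j))

/-- If the numerator for u vanishes, the one for Au is -(w·u)p. Its degree is below that of the
monic p, so w·u = 0 and the numerator for Au vanishes too; iterate. -/
theorem dotProduct_pow_mulVec_eq_zero [Nontrivial R] {A : Matrix ι ι R} {w v : ι → R}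
    (h : resNum A w v = 0) (k : ℕ) : w ⬝ᵥ (A ^ k *ᵥ v) = 0 := by
  have key : ∀ u : ι → R, resNum A w u = 0 → w ⬝ᵥ u = 0 ∧ resNum A w (A *ᵥ u) = 0 := by
    intro u hu
    have h1 := resNum_mulVec A w u
    rw [hu, mul_zero, zero_sub] at h1
    have h2 := degree_resNum_lt A w (A *ᵥ u)
    by_cases h0 : w ⬝ᵥ u = 0
    · exact ⟨h0, by rw [h1, h0]; simp⟩
    · exfalso
      rw [degree_lt_iff_coeff_zero] at h2
      have h3 := h2 (Fintype.card ι) le_rfl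
      rw [h1, coeff_neg, coeff_mul_C, ← charpoly_natDegree_eq_dim A,
        (charpoly_monic A).coeff_natDegree, one_mul, neg_eq_zero] at h3
      exact h0 h3
  have : resNum A w (A ^ k *ᵥ v) = 0 := by
    induction k with
    | zero => simpa using h
    | succ k ih => rw [pow_succ', ← mulVec_mulVec]; exact (key _ ih).2
  exact (key _ this).1

theorem charmatrix_add_smul_one (A : Matrix ι ι R) (a : R) :
    charmatrix (A + a • 1) = (compRingHom (X - C a)).mapMatrix (charmatrix A) := by
  ext1 i j
  by_cases hij : i = j
  · subst hij
    simp
    ring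
  · simp [hij]

theorem charpoly_add_smul_one (A : Matrix ι ι R) (a : R) :
    (A + a • 1).charpoly = A.charpoly.comp (X - C a) := by
  rw [charpoly, charmatrix_add_smul_one, ← RingHom.map_det]; rfl

theorem resNum_add_smul_one (A : Matrix ι ι R) (a : R) (w v : ι → R) :
    resNum (A + a • 1) w v = (resNum A w v).comp (X - C a) := by
  have h : (charmatrix (A + a • 1)).adjugate
      = (compRingHom (X - C a)).mapMatrix (charmatrix A).adjugate := by
    rw [charmatrix_add_smul_one, RingHom.map_adjugate]
  simp [resNum_eq_sum, h, Polynomial.sum_comp]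

end Resolvent

end ResetControl

end

noncomputable section

namespace ResetControl

open Matrix Polynomial

/-! ### Spectral factorization -/

section SpectralFactorization

/-- The form a² + Xb² is the norm of a + b√(-X), hence multiplicative. -/
theorem exists_sq_add_X_mul_sq_mul {f g a b c d : ℝ[X]} (hf : f = a ^ 2 + X * b ^ 2)
    (hg : g = c ^ 2 + X * d ^ 2) : ∃ u v : ℝ[X], f * g = u ^ 2 + X * v ^ 2 :=
  ⟨a * c - X * b * d, a * d + b * c, by rw [hf, hg]; ring⟩

theorem eval_nonneg_of_forall_pos {f : ℝ[X]} (h : ∀ x > 0, 0 ≤ f.eval x) :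
    ∀ x ≥ 0, 0 ≤ f.eval x := by
  intro x hx
  have hc : ContinuousWithinAt (fun y => f.eval y) (Set.Ioi x) x := f.continuous.continuousWithinAt
  exact ge_of_tendsto hc (eventually_mem_nhdsWithin.mono fun y hy =>
    h y (lt_of_le_of_lt hx hy))

/-- A real polynomial that is nonnegative on `[0, ∞)` has the form `a² + X b²`. -/
theorem exists_eq_sq_add_X_mul_sq (h : ℝ[X]) (hh : ∀ x ≥ 0, 0 ≤ h.eval x) :
    ∃ a b : ℝ[X], h = a ^ 2 + X * b ^ 2 := by
  induction hn : h.natDegree using Nat.strong_induction_on generalizing h with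
  | _ n ih =>
  by_cases hd : h.degree ≤ 0
  · rw [eq_C_of_degree_le_zero hd] at hh ⊢
    refine ⟨C √(h.coeff 0), 0, ?_⟩
    rw [← C_pow, Real.sq_sqrt (by simpa using hh 0 le_rfl)]
    simp
  have h0 : h ≠ 0 := by rintro rfl; simp at hd
  -- Induction on the degree: split off a factor f of the required form whose cofactor is still
  -- nonnegative. Positive arguments suffice for the cofactor, which matters when f vanishes at 0.
  have step : ∀ f g : ℝ[X], h = f * g → 0 < f.natDegree → (∀ x > 0, 0 ≤ g.eval x) →
      (∃ a b : ℝ[X], f = a ^ 2 + X * b ^ 2) → ∃ a b : ℝ[X], h = a ^ 2 + X * b ^ 2 := by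
    rintro f g hfg hf hg ⟨a, b, hab⟩
    have hf0 : f ≠ 0 := by rintro rfl; simp at hf
    have hg0 : g ≠ 0 := by rintro rfl; simp [hfg] at h0
    have hlt : g.natDegree < n := by
      rw [← hn, hfg, natDegree_mul hf0 hg0]; omega
    obtain ⟨c, d, hcd⟩ := ih _ hlt g (eval_nonneg_of_forall_pos hg) rfl
    rw [hfg]
    exact exists_sq_add_X_mul_sq_mul hab hcd
  obtain ⟨z, hz⟩ := IsAlgClosed.exists_aeval_eq_zero ℂ h (by
    intro h'; exact hd h'.le)
  by_cases him : z.im = 0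
  · have hz' : h.IsRoot z.re := by
      have : (z.re : ℂ) = z := Complex.ext (by simp) (by simp [him])
      rw [← this] at hz
      have h2 : aeval ((algebraMap ℝ ℂ) z.re) h = 0 := hz
      rw [aeval_algebraMap_apply] at h2
      simpa [IsRoot, aeval_def] using h2
    obtain ⟨g, hg⟩ := dvd_iff_isRoot.2 hz'
    set α := z.re
    rcases le_or_gt α 0 with hα | hα
    · refine step _ g hg (by simp) (fun x hx => ?_) ⟨C √(-α), 1, ?_⟩
      · have := hh x hx.le
        rw [hg, eval_mul] at this
        refine nonneg_of_mul_nonneg_right this ?_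
        simp; linarith
      · rw [← C_pow, Real.sq_sqrt (by linarith)]
        simp; ring
    -- A positive root is at least double, because h does not change sign there; the square (X - α)²
    -- is split off.
    · have hg0 : g.IsRoot α := by
        have h1 : 0 ≤ g.eval α := by
          have hc : ContinuousWithinAt (fun y => g.eval y) (Set.Ioi α) α :=
            g.continuous.continuousWithinAt
          refine ge_of_tendsto hc (eventually_mem_nhdsWithin.mono fun y hy => ?_)
          have hy' : α < y := hy
          have := hh y (hα.trans hy').le
          rw [hg, eval_mul] at this
          refine nonneg_of_mul_nonneg_right this ?_
          simpa using hy'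
        have h2 : g.eval α ≤ 0 := by
          have hc : ContinuousWithinAt (fun y => g.eval y) (Set.Iio α) α :=
            g.continuous.continuousWithinAt
          refine le_of_tendsto hc ?_
          filter_upwards [eventually_mem_nhdsWithin,
            mem_nhdsWithin_of_mem_nhds (Ioi_mem_nhds hα)] with y hy hy0
          have hy' : y < α := hy
          have := hh y (le_of_lt hy0)
          rw [hg, eval_mul] at this
          simp only [eval_sub, eval_X, eval_C] at this
          by_contra! hcon
          exact absurd this (not_le.2 (mul_neg_of_neg_of_pos (by linarith) hcon))
        exact le_antisymm h2 h1
      obtain ⟨k, hk⟩ := dvd_iff_isRoot.2 hg0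
      have hk' : h = (X - C α) ^ 2 * k := by rw [hg, hk]; ring
      refine step _ k hk' (by simp) ?_ ⟨X - C α, 0, by simp⟩
      have hpos : ∀ x ≥ 0, x ≠ α → 0 ≤ k.eval x := by
        intro x hx hxα
        have := hh x hx
        rw [hk', eval_mul] at this
        refine nonneg_of_mul_nonneg_right this ?_
        have : x - α ≠ 0 := sub_ne_zero.2 hxα
        simp; positivity
      intro x hx
      have hc : ContinuousWithinAt (fun y => k.eval y) (Set.Ioi x) x :=
        k.continuous.continuousWithinAt
      refine ge_of_tendsto hc ?_
      rcases lt_or_ge x α with hxα | hxα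
      · filter_upwards [eventually_mem_nhdsWithin,
            mem_nhdsWithin_of_mem_nhds (Iio_mem_nhds hxα)] with y hy hy0
        exact hpos y (hx.trans hy).le (ne_of_lt hy0)
      · filter_upwards [eventually_mem_nhdsWithin] with y hy
        exact hpos y (hx.trans hy).le (ne_of_gt (lt_of_le_of_lt hxα hy))
  -- The conjugate pair contributes X² - 2Re(z)X + |z|² = (X - |z|)² + X(2|z| - 2Re z).
  · obtain ⟨g, hg⟩ := quadratic_dvd_of_aeval_eq_zero_im_ne_zero h hz him
    have hre : z.re ≤ ‖z‖ := (le_abs_self _).trans (Complex.abs_re_le_norm z)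
    refine step _ g hg ?_ (fun x hx => ?_) ⟨X - C ‖z‖, C √(2 * ‖z‖ - 2 * z.re), ?_⟩
    · rw [show X ^ 2 - C (2 * z.re) * X + C (‖z‖ ^ 2)
          = C 1 * X ^ 2 + C (-(2 * z.re)) * X + C (‖z‖ ^ 2) by simp; ring,
        natDegree_quadratic one_ne_zero]
      norm_num
    · have := hh x hx.le
      rw [hg, eval_mul] at this
      refine nonneg_of_mul_nonneg_right this ?_
      simp only [eval_add, eval_sub, eval_mul, eval_pow, eval_X, eval_C]
      have h1 : ‖z‖ ^ 2 = z.re ^ 2 + z.im ^ 2 := by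
        rw [← Complex.normSq_eq_norm_sq, Complex.normSq_apply]; ring
      rw [h1]
      have : 0 < z.im ^ 2 := by positivity
      nlinarith [sq_nonneg (x - z.re)]
    · rw [← C_pow, Real.sq_sqrt (by linarith)]
      simp only [C_sub, C_mul, C_pow, map_ofNat]
      ring

theorem exists_eq_comp_neg_X_sq {φ : ℝ[X]} (heven : φ.comp (-X) = φ) :
    ∃ h : ℝ[X], φ = h.comp (-X ^ 2) := by
  refine ⟨(contract 2 φ).comp (-X), ?_⟩
  have h1 : φ = expand ℝ 2 (contract 2 φ) := by
    ext k
    rw [coeff_expand two_pos]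
    split_ifs with hk
    · rw [coeff_contract two_ne_zero, Nat.div_mul_cancel hk]
    · have := congrArg (fun f => f.coeff k) heven
      rw [show (-X : ℝ[X]) = C (-1) * X by simp, comp_C_mul_X_coeff,
        (Nat.not_even_iff_odd.1 fun h => hk h.two_dvd).neg_one_pow] at this
      linarith
  rw [comp_assoc]
  simpa [expand_eq_comp_X_pow] using h1

/-- Spectral factorization of an even real polynomial that is nonnegative on the imaginary axis. -/
theorem exists_spectralFactor {φ : ℝ[X]} (heven : φ.comp (-X) = φ)
    (hpos : ∀ ω : ℝ, 0 ≤ (aeval (ω * Complex.I) φ).re) :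
    ∃ r : ℝ[X], r * r.comp (-X) = φ := by
  obtain ⟨h, rfl⟩ := exists_eq_comp_neg_X_sq heven
  obtain ⟨a, b, hab⟩ := exists_eq_sq_add_X_mul_sq h (by
    intro x hx
    have h1 := hpos √x
    have h2 : aeval ((√x : ℂ) * Complex.I) (-X ^ 2 : ℝ[X]) = algebraMap ℝ ℂ x := by
      simp only [map_neg, map_pow, aeval_X, mul_pow, Complex.I_sq]
      rw [← Complex.ofReal_pow, Real.sq_sqrt hx]
      simp
    rw [aeval_comp, h2, aeval_algebraMap_apply] at h1
    simpa using h1)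
  -- With h = a² + Xb² and φ = h(-X²), φ = a(-X²)² - X²b(-X²)² is a difference of squares whose two
  -- factors are exchanged by X ↦ -X.
  refine ⟨a.comp (-X ^ 2) + X * b.comp (-X ^ 2), ?_⟩
  have hx : ((-X ^ 2 : ℝ[X])).comp (-X) = -X ^ 2 := by simp
  rw [hab]
  simp only [add_comp, mul_comp, X_comp, comp_assoc, hx, pow_comp]
  ring

theorem natDegree_comp_neg_X (r : ℝ[X]) : (r.comp (-X)).natDegree = r.natDegree := by
  simp [natDegree_comp]

end SpectralFactorization

end ResetControl

end

noncomputable section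

namespace ResetControl

open Matrix Polynomial

/-! ### The Lyapunov equation via the Cayley transform -/

section Lyapunov

variable {ι : Type*} [Fintype ι] [DecidableEq ι]

theorem det_smul_one_sub_map_ofReal (A : Matrix ι ι ℝ) (s : ℂ) :
    (s • (1 : Matrix ι ι ℂ) - A.map Complex.ofReal).det = aeval s A.charpoly := by
  have h := eval_charpoly (A.map Complex.ofReal) s
  rw [show A.map Complex.ofReal = A.map (algebraMap ℝ ℂ) from rfl, charpoly_map, eval_map_algebraMap,
    scalar_apply, ← smul_one_eq_diagonal] at h
  exact h.symm

-- Gelfand's formula: ρ is chosen strictly between the spectral radius and 1, and each entry is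
-- bounded by the operator norm.
open scoped Matrix.Norms.Operator in
theorem eventually_abs_pow_apply_le [Nonempty ι] (M : Matrix ι ι ℝ)
    (hM : ∀ z ∈ spectrum ℂ (M.map Complex.ofReal), ‖z‖ < 1) :
    ∃ ρ : ℝ, 0 ≤ ρ ∧ ρ < 1 ∧ ∀ᶠ k : ℕ in atTop, ∀ i j, |(M ^ k) i j| ≤ ρ ^ k := by
  have h1 : spectralRadius ℂ (M.map Complex.ofReal) < 1 :=
    spectrum.spectralRadius_lt_of_forall_lt (r := 1) _ fun z hz => hM z hz
  obtain ⟨ρ, hρ1, hρ2⟩ := ENNReal.lt_iff_exists_nnreal_btwn.1 h1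
  refine ⟨ρ, ρ.2, by exact_mod_cast hρ2, ?_⟩
  have h2 := (spectrum.pow_nnnorm_pow_one_div_tendsto_nhds_spectralRadius
    (M.map Complex.ofReal)).eventually_lt_const hρ1
  filter_upwards [h2, eventually_gt_atTop 0] with k hk hk0 i j
  have h3 : (‖M.map Complex.ofReal ^ k‖₊ : ENNReal) < (ρ : ENNReal) ^ (k : ℝ) := by
    have := ENNReal.rpow_lt_rpow hk (show (0 : ℝ) < k by exact_mod_cast hk0)
    rwa [← ENNReal.rpow_mul, one_div, inv_mul_cancel₀ (by positivity), ENNReal.rpow_one] at this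
  rw [ENNReal.rpow_natCast] at h3
  have h4 : ‖M.map Complex.ofReal ^ k‖₊ < ρ ^ k := by exact_mod_cast h3
  have h5 : ‖(M.map Complex.ofReal ^ k) i j‖₊ ≤ ‖M.map Complex.ofReal ^ k‖₊ := by
    rw [linfty_opNNNorm_def]
    refine le_trans ?_ (Finset.le_sup (Finset.mem_univ i))
    exact Finset.single_le_sum (f := fun j => ‖(M.map Complex.ofReal ^ k) i j‖₊)
      (fun _ _ => zero_le) (Finset.mem_univ j)
  have h6 : (M.map Complex.ofReal ^ k) i j = ((M ^ k) i j : ℝ) := by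
    have := congrFun (congrFun (map_pow (Complex.ofRealHom.mapMatrix (m := ι)) M k) i) j
    exact this.symm
  rw [h6] at h5
  have h7 := h5.trans h4.le
  rw [← NNReal.coe_le_coe] at h7
  simpa using h7

/-- P is the sum of (lM^k)ᵀ(lM^k) over k ≥ 0. Conjugating by M shifts this geometrically convergent
series and loses its first term. -/
theorem exists_stein_solution (M : Matrix ι ι ℝ) (l : ι → ℝ) {ρ : ℝ} (hρ0 : 0 ≤ ρ) (hρ1 : ρ < 1)
    (hM : ∀ᶠ k : ℕ in atTop, ∀ i j, |(M ^ k) i j| ≤ ρ ^ k) :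
    ∃ P : Matrix ι ι ℝ, P.PosSemidef ∧ Mᵀ * P * M = P - vecMulVec l l := by
  set v : ℕ → ι → ℝ := fun k => l ᵥ* M ^ k with hv
  have hb : ∀ᶠ k : ℕ in atTop, ∀ i, |v k i| ≤ (∑ j, |l j|) * ρ ^ k := by
    filter_upwards [hM] with k hk i
    rw [Finset.sum_mul]
    refine (Finset.abs_sum_le_sum_abs _ _).trans (Finset.sum_le_sum fun j _ => ?_)
    rw [abs_mul]
    exact mul_le_mul_of_nonneg_left (hk j i) (abs_nonneg _)
  have hs : Summable fun k => vecMulVec (v k) (v k) := by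
    refine Pi.summable.2 fun i => Pi.summable.2 fun j => ?_
    refine Summable.of_norm_bounded_eventually_nat
      (g := fun k => (∑ j, |l j|) ^ 2 * ρ ^ k)
      ((summable_geometric_of_lt_one hρ0 hρ1).mul_left _) ?_
    filter_upwards [hb] with k hk
    rw [vecMulVec_apply, Real.norm_eq_abs, abs_mul]
    refine (mul_le_mul (hk i) (hk j) (abs_nonneg _) (by positivity)).trans ?_
    have h1 : ρ ^ k * ρ ^ k ≤ ρ ^ k :=
      mul_le_of_le_one_right (by positivity) (pow_le_one₀ hρ0 hρ1.le)
    calc _ = (∑ j, |l j|) ^ 2 * (ρ ^ k * ρ ^ k) := by ring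
      _ ≤ _ := mul_le_mul_of_nonneg_left h1 (by positivity)
  obtain ⟨P, hP⟩ := hs
  have hpsd : P.PosSemidef := by
    refine PosSemidef.of_dotProduct_mulVec_nonneg ?_ fun x => ?_
    · have h1 := hP.matrix_conjTranspose
      refine h1.unique ?_
      simpa [conjTranspose_vecMulVec] using hP
    · have h1 : HasSum (fun k => star x ⬝ᵥ (vecMulVec (v k) (v k) *ᵥ x)) (star x ⬝ᵥ (P *ᵥ x)) := by
        have hc : Continuous fun Q : Matrix ι ι ℝ => star x ⬝ᵥ (Q *ᵥ x) := by fun_prop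
        exact hP.map (AddMonoidHom.mk' (fun Q : Matrix ι ι ℝ => star x ⬝ᵥ (Q *ᵥ x))
          (by intro a b; simp [add_mulVec])) hc
      refine h1.nonneg fun k => ?_
      rw [vecMulVec_mulVec]
      simp only [star_trivial, dotProduct_smul, op_smul_eq_smul, smul_eq_mul]
      rw [dotProduct_comm]
      exact mul_self_nonneg _
  refine ⟨P, hpsd, ?_⟩
  have h1 : HasSum (fun k => Mᵀ * vecMulVec (v k) (v k) * M) (Mᵀ * P * M) :=
    (hP.mul_left Mᵀ).mul_right M
  have h2 : ∀ k, Mᵀ * vecMulVec (v k) (v k) * M = vecMulVec (v (k + 1)) (v (k + 1)) := by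
    intro k
    rw [mul_vecMulVec, vecMulVec_mul, mulVec_transpose, hv]
    simp only [vecMul_vecMul, pow_succ]
  simp only [h2] at h1
  have h3 := (hasSum_nat_add_iff' 1).2 hP
  have h4 := h1.unique h3
  simpa [hv] using h4

/-- For the Cayley transform M, (z - M)(1 - A) = (z - 1) - (z + 1)A. If |z| ≥ 1 and z ≠ -1, then (z
- 1)/(z + 1) has nonnegative real part and is no eigenvalue of A; z = -1 leaves the invertible -2.
-/
theorem norm_lt_one_of_mem_spectrum_cayley {A : Matrix ι ι ℝ}
    (hA : ∀ s : ℂ, 0 ≤ s.re → aeval s A.charpoly ≠ 0) (z : ℂ)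
    (hz : z ∈ spectrum ℂ (((1 + A) * (1 - A)⁻¹).map Complex.ofReal)) : ‖z‖ < 1 := by
  by_contra! hcon
  have hdet : IsUnit (1 - A).det := by
    have h1 := hA 1 (by simp)
    rw [← det_smul_one_sub_map_ofReal, one_smul] at h1
    have h2 : (1 : Matrix ι ι ℂ) - A.map Complex.ofReal = (1 - A).map Complex.ofRealHom := by
      ext i j; by_cases hij : i = j <;> simp [hij, one_apply]
    rw [h2, ← RingHom.mapMatrix_apply, ← RingHom.map_det] at h1
    exact isUnit_iff_ne_zero.2 fun h => h1 (by simp [h])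
  set Ac : Matrix ι ι ℂ := Complex.ofRealHom.mapMatrix A
  have hdetc : IsUnit (1 - Ac).det := by
    have := hdet.map Complex.ofRealHom
    rwa [RingHom.map_det, map_sub, map_one] at this
  set Mc : Matrix ι ι ℂ := ((1 + A) * (1 - A)⁻¹).map Complex.ofReal with hMc
  have hM : Mc * (1 - Ac) = 1 + Ac := by
    have h1 : Mc = Complex.ofRealHom.mapMatrix ((1 + A) * (1 - A)⁻¹) := rfl
    rw [h1, show (1 - Ac) = Complex.ofRealHom.mapMatrix (1 - A) by
      rw [map_sub, map_one], ← map_mul, mul_assoc, nonsing_inv_mul _ hdet, mul_one, map_add, map_one]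
  refine spectrum.mem_iff.1 hz ?_
  rw [isUnit_iff_isUnit_det]
  have h1 : (algebraMap ℂ (Matrix ι ι ℂ) z - Mc) * (1 - Ac)
      = (z - 1) • (1 : Matrix ι ι ℂ) - (z + 1) • Ac := by
    rw [sub_mul, hM, Algebra.algebraMap_eq_smul_one, smul_mul_assoc, one_mul]
    module
  have h2 : IsUnit ((z - 1) • (1 : Matrix ι ι ℂ) - (z + 1) • Ac).det := by
    by_cases hz1 : z + 1 = 0
    · rw [hz1, zero_smul, sub_zero, det_smul, det_one, mul_one, isUnit_iff_ne_zero]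
      refine pow_ne_zero _ ?_
      rw [show z - 1 = z + 1 - 2 by ring, hz1]; norm_num
    · have h3 : (z - 1) • (1 : Matrix ι ι ℂ) - (z + 1) • Ac
          = (z + 1) • (((z - 1) / (z + 1)) • (1 : Matrix ι ι ℂ) - Ac) := by
        rw [smul_sub, smul_smul, mul_div_cancel₀ _ hz1]
      rw [h3, det_smul, isUnit_iff_ne_zero]
      refine mul_ne_zero (pow_ne_zero _ hz1) ?_
      have h4 := hA ((z - 1) / (z + 1)) ?_
      · rwa [← det_smul_one_sub_map_ofReal] at h4
      · rw [Complex.div_re, ← add_div]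
        refine div_nonneg ?_ (Complex.normSq_nonneg _)
        have h5 : 1 ≤ z.re * z.re + z.im * z.im := by
          rw [← Complex.normSq_apply, Complex.normSq_eq_norm_sq]
          nlinarith
        simp only [Complex.sub_re, Complex.add_re, Complex.sub_im, Complex.add_im, Complex.one_re,
          Complex.one_im]
        nlinarith
  rw [← h1, det_mul] at h2
  exact (IsUnit.mul_iff.1 h2).1

/-- The Lyapunov equation of a Hurwitz matrix has a positive semidefinite solution. -/
theorem exists_lyapunov_solution [Nonempty ι] {A : Matrix ι ι ℝ}
    (hA : ∀ s : ℂ, 0 ≤ s.re → aeval s A.charpoly ≠ 0) (l : ι → ℝ) :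
    ∃ P : Matrix ι ι ℝ, P.PosSemidef ∧ Aᵀ * P + P * A = -vecMulVec l l := by
  have hdet : IsUnit (1 - A).det := by
    have h1 := hA 1 (by simp)
    have h2 := eval_charpoly A 1
    rw [map_one] at h2
    rw [← h2, isUnit_iff_ne_zero]
    intro h3
    apply h1
    rw [show (1 : ℂ) = algebraMap ℝ ℂ 1 by simp, aeval_algebraMap_apply]
    simp [aeval_def, h3]
  obtain ⟨ρ, hρ0, hρ1, hρ⟩ := eventually_abs_pow_apply_le ((1 + A) * (1 - A)⁻¹)
    (norm_lt_one_of_mem_spectrum_cayley hA)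
  -- The factor √2 compensates (1 + A)ᵀP(1 + A) - (1 - A)ᵀP(1 - A) = 2(AᵀP + PA).
  obtain ⟨P, hP, hst⟩ := exists_stein_solution ((1 + A) * (1 - A)⁻¹)
    (√2 • (l ᵥ* (1 - A)⁻¹)) hρ0 hρ1 hρ
  refine ⟨P, hP, ?_⟩
  have h1 : ((1 + A) * (1 - A)⁻¹) * (1 - A) = 1 + A := by
    rw [mul_assoc, nonsing_inv_mul _ hdet, mul_one]
  have h2 : (1 + A)ᵀ * P * (1 + A)
      = (1 - A)ᵀ * P * (1 - A) - (2 : ℝ) • vecMulVec l l := by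
    have h3 : (1 + A)ᵀ * P * (1 + A) = (1 - A)ᵀ * (P - vecMulVec (√2 • (l ᵥ* (1 - A)⁻¹))
        (√2 • (l ᵥ* (1 - A)⁻¹))) * (1 - A) := by
      rw [← hst]
      nth_rw 1 2 [← h1]
      rw [transpose_mul]
      simp only [mul_assoc]
    rw [h3, Matrix.mul_sub _ P, Matrix.sub_mul (_ * P)]
    congr 1
    rw [mul_vecMulVec, vecMulVec_mul, mulVec_transpose, smul_vecMul, vecMul_vecMul,
      nonsing_inv_mul _ hdet, vecMul_one, smul_vecMulVec, vecMulVec_smul, smul_smul,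
      Real.mul_self_sqrt (by norm_num)]
  simp only [transpose_add, transpose_sub, transpose_one, add_mul, mul_add, sub_mul, mul_sub,
    one_mul, mul_one] at h2
  have h4 : (2 : ℝ) • (Aᵀ * P + P * A) = (2 : ℝ) • (-vecMulVec l l) := by
    rw [smul_neg]
    rw [eq_comm, ← sub_eq_zero] at h2 ⊢
    rw [← h2]
    module
  exact smul_right_injective _ two_ne_zero h4

end Lyapunov

end ResetControl

end

noncomputable section

namespace ResetControl

open Matrix Polynomial

/-! ### The positive real lemma -/

section PositiveReal

variable {ι : Type*} [Fintype ι] [DecidableEq ι]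

theorem isCoprime_comp_neg_X {p : ℝ[X]} (hp : ∀ s : ℂ, 0 ≤ s.re → aeval s p ≠ 0) :
    IsCoprime p (p.comp (-X)) := by
  rw [isCoprime_iff_aeval_ne_zero_of_isAlgClosed ℝ ℂ]
  intro s
  rcases le_total 0 s.re with hs | hs
  · exact Or.inl (hp s hs)
  · refine Or.inr ?_
    rw [aeval_comp]
    exact hp _ (by simpa using hs)

/-- The map from w to its numerator is injective between spaces of equal dimension N, hence onto. -/
theorem exists_resNum_eq {A : Matrix ι ι ℝ} {b : ι → ℝ} (hb : ∀ w, resNum A w b = 0 → w = 0)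
    {r : ℝ[X]} (hr : r.degree < Fintype.card ι) : ∃ w, resNum A w b = r := by
  set F : (ι → ℝ) →ₗ[ℝ] degreeLT ℝ (Fintype.card ι) :=
    (resNumLeft A b).codRestrict _ fun w => mem_degreeLT.2 (degree_resNum_lt A w b)
  have hinj : Function.Injective F := by
    rw [← LinearMap.ker_eq_bot, LinearMap.ker_eq_bot']
    intro w hw
    exact hb w (congrArg Subtype.val hw)
  have hrank : Module.finrank ℝ (ι → ℝ) = Module.finrank ℝ (degreeLT ℝ (Fintype.card ι)) := by
    rw [(degreeLTEquiv ℝ (Fintype.card ι)).finrank_eq]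
    simp
  have : FiniteDimensional ℝ (degreeLT ℝ (Fintype.card ι)) :=
    (degreeLTEquiv ℝ (Fintype.card ι)).symm.finiteDimensional
  obtain ⟨w, hw⟩ := (LinearMap.injective_iff_surjective_of_finrank_eq_finrank hrank).1 hinj
    ⟨r, mem_degreeLT.2 hr⟩
  exact ⟨w, congrArg Subtype.val hw⟩

/-- The positive real lemma for a minimal realization of a single-input single-output system without
feedthrough whose state matrix is Hurwitz. -/
theorem exists_posDef_of_positiveReal [Nonempty ι] {A : Matrix ι ι ℝ} {b c : ι → ℝ}
    (hA : ∀ s : ℂ, 0 ≤ s.re → aeval s A.charpoly ≠ 0)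
    (hb : ∀ w, resNum A w b = 0 → w = 0)
    (hc : ∀ v, (∀ k : ℕ, c ⬝ᵥ (A ^ k *ᵥ v) = 0) → v = 0)
    (hpos : ∀ ω : ℝ, 0 ≤ (aeval (ω * Complex.I) (resNum A c b)
      * (starRingEnd ℂ) (aeval (ω * Complex.I) A.charpoly)).re) :
    ∃ P : Matrix ι ι ℝ, P.PosDef ∧ P *ᵥ b = c ∧ ∀ x, x ⬝ᵥ (P *ᵥ (A *ᵥ x)) ≤ 0 := by
  set p := A.charpoly with hp
  set q := resNum A c b with hq
  have hpdeg : p.natDegree = Fintype.card ι := charpoly_natDegree_eq_dim A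
  have hN : 0 < Fintype.card ι := Fintype.card_pos
  have hconj : ∀ (f : ℝ[X]) (ω : ℝ), aeval (ω * Complex.I) (f.comp (-X))
      = (starRingEnd ℂ) (aeval (ω * Complex.I) f) := by
    intro f ω
    rw [aeval_comp, ← aeval_conj]
    simp
  obtain ⟨r, hr⟩ := exists_spectralFactor (φ := q * p.comp (-X) + q.comp (-X) * p)
    (by simp only [add_comp, mul_comp_neg_X, comp_neg_X_comp_neg_X]; ring)
    (fun ω => by
      have h1 : aeval (ω * Complex.I) (q * p.comp (-X) + q.comp (-X) * p)
          = aeval (ω * Complex.I) q * (starRingEnd ℂ) (aeval (ω * Complex.I) p)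
          + (starRingEnd ℂ) (aeval (ω * Complex.I) q
            * (starRingEnd ℂ) (aeval (ω * Complex.I) p)) := by
        simp only [map_add, map_mul, hconj, Complex.conj_conj]
      rw [h1, Complex.add_re, Complex.conj_re]
      exact add_nonneg (hpos ω) (hpos ω))
  have hqdeg : q.natDegree < Fintype.card ι := by
    by_cases hq0 : q = 0
    · simpa [hq0] using hN
    · exact (natDegree_lt_iff_degree_lt hq0).2 (degree_resNum_lt A c b)
  have hrdeg : r.degree < Fintype.card ι := by
    by_cases hr0 : r = 0
    · rw [hr0, degree_zero]; exact WithBot.bot_lt_coe _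
    rw [← natDegree_lt_iff_degree_lt hr0]
    have h1 := congrArg natDegree hr
    have hr0' : r.comp (-X) ≠ 0 := fun h => hr0 (by
      have := congrArg (fun f => f.comp (-X)) h
      simpa [comp_neg_X_comp_neg_X] using this)
    rw [natDegree_mul hr0 hr0', natDegree_comp_neg_X] at h1
    have h2 : (q * p.comp (-X) + q.comp (-X) * p).natDegree
        ≤ q.natDegree + Fintype.card ι := by
      refine natDegree_add_le_of_degree_le (natDegree_mul_le.trans ?_) (natDegree_mul_le.trans ?_)
      · rw [natDegree_comp_neg_X, hpdeg]
      · rw [natDegree_comp_neg_X, hpdeg]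
    omega
  obtain ⟨l, hl⟩ := exists_resNum_eq hb hrdeg
  obtain ⟨P, hP, hlyap⟩ := exists_lyapunov_solution hA l
  have hsymm : Pᵀ = P := hP.isHermitian
  have hPsymm : ∀ x y : ι → ℝ, x ⬝ᵥ (P *ᵥ y) = (P *ᵥ x) ⬝ᵥ y := by
    intro x y
    rw [dotProduct_mulVec, ← mulVec_transpose, hsymm]
  have hform : ∀ x y : ι → ℝ, (A *ᵥ x) ⬝ᵥ (P *ᵥ y) + x ⬝ᵥ (P *ᵥ (A *ᵥ y))
      = -((l ⬝ᵥ x) * (l ⬝ᵥ y)) := by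
    intro x y
    have h1 := congrArg (fun Q => x ⬝ᵥ (Q *ᵥ y)) hlyap
    simp only [add_mulVec, ← mulVec_mulVec, dotProduct_add, neg_mulVec, vecMulVec_mulVec,
      dotProduct_neg, op_smul_eq_smul, dotProduct_smul, smul_eq_mul] at h1
    rw [dotProduct_mulVec x, vecMul_transpose] at h1
    rw [h1, dotProduct_comm x l, mul_comm]
  have hPb : P *ᵥ b = c := by
    set f := resNum A (P *ᵥ b - c) b with hf
    -- Evaluate the Lyapunov form at x = adj(-s - A)b and y = adj(s - A)b. The terms in s cancel,
    -- leaving p(-s)g(s) + p(s)g(-s) = r(s)r(-s) for g the numerator of Pb; subtracting the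
    -- factorization replaces g by f.
    have h1 : p.comp (-X) * f = -(p * f.comp (-X)) := by
      refine Polynomial.funext fun s => ?_
      have h2 := hform (fun i => (adjVec A b i).eval (-s)) (fun i => (adjVec A b i).eval s)
      rw [mulVec_eval_adjVec, mulVec_eval_adjVec, mulVec_sub, mulVec_smul, mulVec_smul,
        dotProduct_sub, sub_dotProduct, smul_dotProduct, smul_dotProduct, dotProduct_smul,
        dotProduct_smul, hPsymm b, dotProduct_comm _ (P *ᵥ b), ← eval_resNum, ← eval_resNum,
        ← eval_resNum, ← eval_resNum, hl] at h2
      have h3 := congrArg (eval s) hr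
      simp only [eval_mul, eval_add, eval_comp, eval_neg, eval_X] at h3
      have h4 : f = resNum A (P *ᵥ b) b - q := resNum_sub_left A _ _ _
      simp only [h4, eval_mul, eval_neg, eval_comp, eval_X, eval_sub]
      simp only [smul_eq_mul, ← hp] at h2
      linear_combination -h2 + h3
    have h2 : p ∣ f := by
      refine (isCoprime_comp_neg_X hA).dvd_of_dvd_mul_left ?_
      rw [h1]
      exact (dvd_mul_right _ _).neg_right
    have h3 : f = 0 := by
      refine eq_zero_of_dvd_of_degree_lt h2 ((degree_resNum_lt A _ b).trans_le ?_)
      rw [hp, charpoly_degree_eq_dim]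
    exact sub_eq_zero.1 (hb _ h3)
  -- The kernel of P is A-invariant and orthogonal to c = Pb, so observability makes it trivial.
  have hker : ∀ x, P *ᵥ x = 0 → P *ᵥ (A *ᵥ x) = 0 := by
    intro x hx
    have h1 := hform x x
    rw [hx, hPsymm x, hx, dotProduct_zero, zero_dotProduct, add_zero, eq_comm, neg_eq_zero,
      mul_self_eq_zero] at h1
    have h2 := congrArg (fun Q => Q *ᵥ x) hlyap
    simp only [add_mulVec, ← mulVec_mulVec, neg_mulVec, vecMulVec_mulVec, op_smul_eq_smul] at h2
    rw [hx, mulVec_zero, zero_add, h1, zero_smul, neg_zero] at h2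
    exact h2
  refine ⟨P, ?_, hPb, ?_⟩
  · refine PosDef.of_dotProduct_mulVec_pos hP.isHermitian fun x hx => ?_
    refine lt_of_le_of_ne (hP.dotProduct_mulVec_nonneg x) fun h0 => hx ?_
    have hx0 := (hP.dotProduct_mulVec_zero_iff x).1 h0.symm
    refine hc x fun k => ?_
    have h2 : P *ᵥ (A ^ k *ᵥ x) = 0 := by
      induction k with
      | zero => simpa using hx0
      | succ k ih => rw [pow_succ', ← mulVec_mulVec]; exact hker _ ih
    rw [← hPb, ← hPsymm, h2, dotProduct_zero]
  · intro x
    have h1 := hform x x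
    rw [hPsymm, dotProduct_comm] at h1
    nlinarith [mul_self_nonneg (l ⬝ᵥ x)]

end PositiveReal

end ResetControl

end

noncomputable section

namespace ResetControl

open Matrix Polynomial

/-! ### Minimal realizations and strict positive realness -/

section Realization

theorem range_mulVecLin_eq_top_of_rank {ι κ : Type*} [Fintype ι] [Fintype κ]
    (M : Matrix ι κ ℝ)
    (hM : M.rank = Fintype.card ι) : LinearMap.range M.mulVecLin = ⊤ :=
  Submodule.eq_top_of_finrank_eq (by rw [← Matrix.rank, hM, Module.finrank_fintype_fun_eq_card])

variable {ι : Type*} [Fintype ι] [DecidableEq ι]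

/-- An `A`-invariant subspace that contains the input vector of a controllable pair is everything. -/
theorem IsControllable.mem_of_invariant {A : Matrix ι ι ℝ} {B : Matrix ι (Fin 1) ℝ}
    (h : IsControllable A B) (W : Submodule ℝ (ι → ℝ)) (hB : (fun i => B i 0) ∈ W)
    (hA : ∀ v ∈ W, A *ᵥ v ∈ W) (v : ι → ℝ) : v ∈ W := by
  have hpow : ∀ k : ℕ, A ^ k *ᵥ (fun i => B i 0) ∈ W := by
    intro k
    induction k with
    | zero => simpa using hB
    | succ k ih => rw [pow_succ', ← mulVec_mulVec]; exact hA _ ih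
  have hv : v ∈ LinearMap.range (Matrix.mulVecLin (Matrix.of fun (i : ι)
      (p : Fin (Fintype.card ι) × Fin 1) => (A ^ (p.1 : ℕ) * B) i p.2)) := by
    rw [range_mulVecLin_eq_top_of_rank _ h]; trivial
  obtain ⟨y, rfl⟩ := hv
  rw [mulVecLin_apply, mulVec_eq_sum]
  refine Submodule.sum_mem _ fun p _ => ?_
  rw [op_smul_eq_smul]
  refine Submodule.smul_mem _ _ ?_
  obtain ⟨k, j⟩ := p
  obtain rfl := Subsingleton.elim j 0
  exact hpow k

theorem IsObservable.isControllable_transpose {A : Matrix ι ι ℝ} {C : Matrix (Fin 1) ι ℝ}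
    (h : IsObservable A C) : IsControllable Aᵀ Cᵀ := by
  rw [IsObservable, ← rank_transpose] at h
  refine Eq.trans (congrArg Matrix.rank ?_) h
  ext i p
  simp only [of_apply, transpose_apply]
  rw [← transpose_pow, ← transpose_mul, transpose_apply]

/-- The vectors v with vanishing numerator form an A-invariant subspace containing the input vector.
So w belongs to it, and w·w = 0. -/
theorem IsControllable.eq_zero_of_resNum {A : Matrix ι ι ℝ} {B : Matrix ι (Fin 1) ℝ}
    (h : IsControllable A B) (w : ι → ℝ) (hw : resNum A w (fun i => B i 0) = 0) : w = 0 := by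
  have hmem := h.mem_of_invariant
    { carrier := {v | resNum A w v = 0}
      add_mem' := fun {u v} hu hv => by
        simp only [Set.mem_ofPred_eq, ← resNum_transpose A] at *
        rw [resNum_add_left, hu, hv, add_zero]
      zero_mem' := by simp [resNum_eq_sum]
      smul_mem' := fun a v hv => by
        simp only [Set.mem_ofPred_eq, ← resNum_transpose A] at *
        rw [resNum_smul_left, hv, smul_zero] } hw
    (fun v hv => by
      change resNum A w (A *ᵥ v) = 0
      have h0 := dotProduct_pow_mulVec_eq_zero hv 0
      rw [pow_zero, one_mulVec] at h0
      rw [resNum_mulVec, show resNum A w v = 0 from hv, h0]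
      simp) w
  have h0 := dotProduct_pow_mulVec_eq_zero hmem 0
  rw [pow_zero, one_mulVec] at h0
  exact dotProduct_self_eq_zero.1 h0

theorem IsObservable.eq_zero_of_forall_pow {A : Matrix ι ι ℝ} {C : Matrix (Fin 1) ι ℝ}
    (h : IsObservable A C) (v : ι → ℝ) (hv : ∀ k : ℕ, C 0 ⬝ᵥ (A ^ k *ᵥ v) = 0) : v = 0 := by
  have hmem := h.isControllable_transpose.mem_of_invariant
    { carrier := {w | ∀ k : ℕ, w ⬝ᵥ (A ^ k *ᵥ v) = 0}
      add_mem' := fun {u w} hu hw k => by rw [add_dotProduct, hu, hw, add_zero]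
      zero_mem' := fun k => zero_dotProduct _
      smul_mem' := fun a w hw k => by rw [smul_dotProduct, hw, smul_zero] } hv
    (fun w hw k => by
      rw [mulVec_transpose, ← dotProduct_mulVec, mulVec_mulVec, ← pow_succ']
      exact hw (k + 1)) v
  have h0 := hmem 0
  rw [pow_zero, one_mulVec] at h0
  exact dotProduct_self_eq_zero.1 h0

/-- A and A + a have the same invariant subspaces, hence the same unobservable vectors. -/
theorem forall_pow_of_forall_add_smul_one_pow {A : Matrix ι ι ℝ} {a : ℝ} {c v : ι → ℝ}
    (h : ∀ k : ℕ, c ⬝ᵥ ((A + a • 1) ^ k *ᵥ v) = 0) (k : ℕ) : c ⬝ᵥ (A ^ k *ᵥ v) = 0 := by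
  induction k generalizing v with
  | zero => simpa using h 0
  | succ k ih =>
    rw [pow_succ, ← mulVec_mulVec]
    refine ih fun j => ?_
    have h1 : A *ᵥ v = (A + a • 1) *ᵥ v - a • v := by
      rw [add_mulVec, smul_mulVec, one_mulVec, add_sub_cancel_right]
    rw [h1, mulVec_sub, mulVec_mulVec, ← pow_succ, dotProduct_sub, h, mulVec_smul, dotProduct_smul,
      h, smul_zero, sub_zero]

theorem transferFunction_eq (A : Matrix ι ι ℝ) (B : Matrix ι (Fin 1) ℝ) (C : Matrix (Fin 1) ι ℝ) :
    transferFunction A B C = algebraMap ℝ[X] (RatFunc ℝ) (resNum A (C 0) fun i => B i 0)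
      / algebraMap ℝ[X] (RatFunc ℝ) A.charpoly := by
  set φ := algebraMap ℝ[X] (RatFunc ℝ)
  have h1 : (RatFunc.X : RatFunc ℝ) • (1 : Matrix ι ι (RatFunc ℝ))
      - A.map (RatFunc.C : ℝ →+* RatFunc ℝ) = φ.mapMatrix (charmatrix A) := by
    ext i j
    by_cases hij : i = j
    · subst hij; simp [φ]
    · simp [φ, hij]
  rw [transferFunction, h1, inv_def, ← RingHom.map_det, ← RingHom.map_adjugate, Ring.inverse_eq_inv',
    div_eq_inv_mul, resNum_eq_sum]
  rw [Matrix.mul_smul, Matrix.smul_mul, Matrix.smul_apply, smul_eq_mul, charpoly]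
  congr 1
  simp only [mul_apply, Finset.sum_mul, map_sum, map_mul, map_apply, RingHom.mapMatrix_apply, φ,
    RatFunc.algebraMap_C]
  rw [Finset.sum_comm]
  refine Finset.sum_congr rfl fun i _ => Finset.sum_congr rfl fun j _ => ?_
  rw [mul_assoc]

/-- For a minimal realization, every eigenvalue of the state matrix is a pole of the transfer
function. -/
theorem charpoly_dvd_denom_pow {A : Matrix ι ι ℝ} {B : Matrix ι (Fin 1) ℝ}
    {C : Matrix (Fin 1) ι ℝ} (hB : IsControllable A B) (hC : IsObservable A C) {f d : ℝ[X]}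
    (h : f * A.charpoly = resNum A (C 0) (fun i => B i 0) * d) :
    A.charpoly ∣ d ^ Fintype.card ι := by
  have h1 : ∀ v, A.charpoly ∣ d * resNum A (C 0) v := by
    refine hB.mem_of_invariant
      { carrier := {v | A.charpoly ∣ d * resNum A (C 0) v}
        add_mem' := fun {u v} hu hv => by
          simp only [Set.mem_ofPred_eq, ← resNum_transpose A] at *
          rw [resNum_add_left, mul_add]
          exact dvd_add hu hv
        zero_mem' := by simp [resNum_eq_sum]
        smul_mem' := fun a v hv => by
          simp only [Set.mem_ofPred_eq, ← resNum_transpose A] at *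
          rw [resNum_smul_left, mul_smul_comm]
          exact dvd_smul_of_dvd _ hv } ?_ fun v hv => ?_
    · exact ⟨f, by rw [mul_comm d, ← h, mul_comm]⟩
    · change A.charpoly ∣ d * resNum A (C 0) (A *ᵥ v)
      rw [resNum_mulVec, mul_sub]
      refine dvd_sub ?_ ?_
      · rw [mul_left_comm]; exact dvd_mul_of_dvd_right hv _
      · rw [mul_left_comm]; exact dvd_mul_right _ _
  have h2 : ∀ v w, A.charpoly ∣ d * resNum A w v := by
    intro v
    refine hC.isControllable_transpose.mem_of_invariant
      { carrier := {w | A.charpoly ∣ d * resNum A w v}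
        add_mem' := fun {u w} hu hw => by
          simp only [Set.mem_ofPred_eq] at *
          rw [resNum_add_left, mul_add]
          exact dvd_add hu hw
        zero_mem' := by simp [resNum_eq_sum]
        smul_mem' := fun a w hw => by
          simp only [Set.mem_ofPred_eq] at *
          rw [resNum_smul_left, mul_smul_comm]
          exact dvd_smul_of_dvd _ hw } (h1 v) fun w hw => ?_
    change A.charpoly ∣ d * resNum A (Aᵀ *ᵥ w) v
    rw [mulVec_transpose, resNum_vecMul, mul_sub]
    refine dvd_sub ?_ ?_
    · rw [mul_left_comm]; exact dvd_mul_of_dvd_right hw _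
    · rw [mul_left_comm]; exact dvd_mul_right _ _
  choose K hK using fun i j => h2 (Pi.single j 1) (Pi.single i 1)
  -- Now p divides every entry of d·adj(X - A). Multiplying by X - A and cancelling p gives d·1 = (X
  -- - A)K, whose determinant is the claim.
  have h3 : d • (charmatrix A).adjugate = A.charpoly • Matrix.of K := by
    ext1 i j
    rw [Matrix.smul_apply, Matrix.smul_apply, of_apply, smul_eq_mul, smul_eq_mul, ← hK, resNum_single]
  have h4 : A.charpoly • (d • (1 : Matrix ι ι ℝ[X]))
      = A.charpoly • (charmatrix A * Matrix.of K) := by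
    rw [← Matrix.mul_smul, ← h3, Matrix.mul_smul, mul_adjugate, smul_comm]; rfl
  have h5 : d • (1 : Matrix ι ι ℝ[X]) = charmatrix A * Matrix.of K := by
    ext1 i j
    have := congrFun (congrFun h4 i) j
    simp only [Matrix.smul_apply, smul_eq_mul] at this ⊢
    exact mul_left_cancel₀ (charpoly_monic A).ne_zero this
  have h6 := congrArg det h5
  rw [det_smul, det_one, mul_one, det_mul] at h6
  exact ⟨_, h6⟩

/-- The Lyapunov matrix that a strictly positive real transfer function with a minimal realization
provides. -/
theorem IsStrictlyPositiveReal.exists_posDef [Nonempty ι] {A : Matrix ι ι ℝ}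
    {B : Matrix ι (Fin 1) ℝ} {C : Matrix (Fin 1) ι ℝ}
    (h : IsStrictlyPositiveReal (transferFunction A B C))
    (hB : IsControllable A B) (hC : IsObservable A C) :
    ∃ P : Matrix ι ι ℝ, ∃ a : ℝ, P.PosDef ∧ 0 < a ∧ P *ᵥ (fun i => B i 0) = C 0 ∧
      ∀ x, x ⬝ᵥ (P *ᵥ (A *ᵥ x)) ≤ -a * (x ⬝ᵥ (P *ᵥ x)) := by
  obtain ⟨ε, hε, hpr⟩ := h
  set H := transferFunction A B C with hH
  set q := resNum A (C 0) (fun i => B i 0) with hq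
  have hp0 := (charpoly_monic A).ne_zero
  have hnum : H.num * A.charpoly = q * H.denom := by
    have h1 := RatFunc.num_div_denom H
    nth_rw 3 [hH] at h1
    have hinj : Function.Injective (algebraMap ℝ[X] (RatFunc ℝ)) :=
      RatFunc.algebraMap_injective ℝ
    rw [transferFunction_eq, div_eq_div_iff] at h1
    · exact hinj (by rw [map_mul, map_mul]; exact h1)
    · exact (map_ne_zero_iff _ hinj).2 H.denom_ne_zero
    · exact (map_ne_zero_iff _ hinj).2 hp0
  have hpole : ∀ s : ℂ, -ε < s.re → aeval s A.charpoly ≠ 0 := by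
    intro s hs hps
    obtain ⟨g, hg⟩ := charpoly_dvd_denom_pow hB hC hnum
    have h1 := congrArg (aeval s) hg
    rw [map_pow, map_mul, hps, zero_mul] at h1
    exact (hpr s hs).1 (eq_zero_of_pow_eq_zero h1)
  have hre : ∀ s : ℂ, -ε < s.re →
      0 ≤ (aeval s q * (starRingEnd ℂ) (aeval s A.charpoly)).re := by
    intro s hs
    have h1 := (hpr s hs).2
    have h2 : RatFunc.eval (algebraMap ℝ ℂ) s H = aeval s q / aeval s A.charpoly := by
      rw [RatFunc.eval, ← aeval_def, ← aeval_def, div_eq_div_iff (hpr s hs).1 (hpole s hs),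
        ← map_mul, ← map_mul, hnum]
    rw [h2] at h1
    have h3 : aeval s q * (starRingEnd ℂ) (aeval s A.charpoly)
        = (aeval s q / aeval s A.charpoly) * (Complex.normSq (aeval s A.charpoly) : ℂ) := by
      rw [Complex.normSq_eq_conj_mul_self]
      have := hpole s hs
      field_simp
    rw [h3, Complex.re_mul_ofReal]
    exact mul_nonneg h1 (Complex.normSq_nonneg _)
  have hshift : ∀ (s : ℂ) (f : ℝ[X]),
      aeval s (f.comp (X - Polynomial.C (ε / 2))) = aeval (s - (ε / 2 : ℝ)) f := by
    intro s f
    rw [aeval_comp]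
    simp
  -- Shifting by ε/2 moves the closed right half-plane into Re s > -ε, where poles and sign are
  -- controlled; undoing the shift turns ≤ 0 into the decay rate ε/2.
  obtain ⟨P, hP, hPb, hPA⟩ := exists_posDef_of_positiveReal (A := A + (ε / 2) • 1)
    (b := fun i => B i 0) (c := C 0)
    (fun s hs => by
      rw [charpoly_add_smul_one, hshift]
      exact hpole _ (by rw [Complex.sub_re, Complex.ofReal_re]; linarith))
    (fun w hw => by
      rw [resNum_add_smul_one] at hw
      refine hB.eq_zero_of_resNum w ?_
      have h1 := congrArg (fun f => f.comp (X + Polynomial.C (ε / 2))) hw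
      simpa [comp_assoc] using h1)
    (fun v hv => hC.eq_zero_of_forall_pow v (forall_pow_of_forall_add_smul_one_pow hv))
    (fun ω => by
      rw [charpoly_add_smul_one, resNum_add_smul_one, hshift, hshift]
      refine hre _ ?_
      simp only [Complex.sub_re, Complex.ofReal_re, Complex.mul_re, Complex.I_re, Complex.ofReal_im,
        Complex.I_im]
      linarith)
  refine ⟨P, ε / 2, hP, by linarith, hPb, fun x => ?_⟩
  have h1 := hPA x
  rw [add_mulVec, smul_mulVec, one_mulVec, mulVec_add, mulVec_smul, dotProduct_add, dotProduct_smul,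
    smul_eq_mul] at h1
  linarith

end Realization

end ResetControl

end

noncomputable section

namespace ResetControl

open Matrix

/-! ### Monotonicity from one-sided information -/

section Monotonicity

/-- A left-continuous function that at every point is locally bounded to the right by its value is
bounded by its initial value. -/
theorem le_of_eventually_right_le {h : ℝ → ℝ} {a b : ℝ} (hab : a ≤ b)
    (hl : ∀ t, a < t → t ≤ b → ContinuousWithinAt h (Set.Iic t) t)
    (hr : ∀ t, a ≤ t → t < b → ∀ᶠ s in 𝓝[>] t, h s ≤ h t) : h b ≤ h a := by
  -- Real induction: at the supremum c the bound persists by left continuity, and if c < b the bound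
  -- to the right would carry it beyond c.
  set S : Set ℝ := {t | a ≤ t ∧ t ≤ b ∧ ∀ s, a ≤ s → s ≤ t → h s ≤ h a} with hS
  have haS : a ∈ S := ⟨le_rfl, hab, fun s h1 h2 => by rw [le_antisymm h2 h1]⟩
  have hbdd : BddAbove S := ⟨b, fun t ht => ht.2.1⟩
  set c := sSup S with hc
  have hac : a ≤ c := le_csSup hbdd haS
  have hcb : c ≤ b := csSup_le ⟨a, haS⟩ fun t ht => ht.2.1
  have hlt : ∀ s, a ≤ s → s < c → h s ≤ h a := by
    intro s hs hsc
    obtain ⟨t, ht, hst⟩ := exists_lt_of_lt_csSup ⟨a, haS⟩ hsc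
    exact ht.2.2 s hs hst.le
  have hcc : h c ≤ h a := by
    rcases hac.eq_or_lt with h1 | h1
    · rw [← h1]
    · have h2 : Tendsto h (𝓝[<] c) (𝓝 (h c)) :=
        (hl c h1 hcb).mono_left (nhdsWithin_mono _ Set.Iio_subset_Iic_self)
      refine le_of_tendsto h2 ?_
      filter_upwards [Ioo_mem_nhdsLT h1] with s hs
      exact hlt s hs.1.le hs.2
  rcases hcb.eq_or_lt with h1 | h1
  · rwa [← h1]
  · exfalso
    obtain ⟨u, hu, hu'⟩ := (mem_nhdsGT_iff_exists_Ioo_subset' h1).1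
      ((hr c hac h1).and (Ioo_mem_nhdsGT h1))
    have hcu : c < u := hu
    have hmem : (c + u) / 2 ∈ S := by
      refine ⟨by linarith, ((hu' ⟨by linarith, by linarith⟩ : _).2.2).le, fun s hs hs' => ?_⟩
      rcases lt_trichotomy s c with h2 | h2 | h2
      · exact hlt s hs h2
      · rw [h2]; exact hcc
      · exact ((hu' ⟨h2, by linarith⟩ : _).1).trans hcc
    have := le_csSup hbdd hmem
    linarith

/-- A left-continuous function that at every point either has a nonpositive right derivative or is
locally bounded to the right by its value is bounded by its initial value. -/
theorem le_of_right_deriv_nonpos_or_eventually_le {g : ℝ → ℝ} {a b : ℝ} (hab : a ≤ b)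
    (hl : ∀ t, a < t → t ≤ b → ContinuousWithinAt g (Set.Iic t) t)
    (hr : ∀ t, a ≤ t → t < b →
      (∃ d ≤ 0, HasDerivWithinAt g d (Set.Ici t) t) ∨ ∀ᶠ s in 𝓝[>] t, g s ≤ g t) :
    g b ≤ g a := by
  -- Tilting by -ηs makes the right derivative negative, which yields a bound on some interval to
  -- the right; then η → 0.
  have key : ∀ η > 0, g b ≤ g a + η * (b - a) := by
    intro η hη
    have h1 := le_of_eventually_right_le (h := fun s => g s - η * s) hab
      (fun t h1 h2 => (hl t h1 h2).sub (by fun_prop)) (fun t h1 h2 => ?_)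
    · linarith
    · rcases hr t h1 h2 with ⟨d, hd, hderiv⟩ | h3
      · have h4 := (hderiv.Ioi_of_Ici).limsup_slope_le' (by simp) (lt_of_le_of_lt hd hη)
        filter_upwards [h4, self_mem_nhdsWithin] with s hs hts
        have hts' : 0 < s - t := sub_pos.2 hts
        rw [slope_def_field, div_lt_iff₀ hts'] at hs
        linarith
      · filter_upwards [h3, self_mem_nhdsWithin] with s hs hts
        have hts' : 0 < s - t := sub_pos.2 hts
        nlinarith
  have hlim : Tendsto (fun η : ℝ => g a + η * (b - a)) (𝓝[>] 0) (𝓝 (g a + 0 * (b - a))) :=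
    ContinuousWithinAt.tendsto (f := fun η : ℝ => g a + η * (b - a)) (by fun_prop)
  have := ge_of_tendsto hlim (eventually_mem_nhdsWithin.mono fun η hη => key η hη)
  linarith

end Monotonicity

/-! ### Quadratic forms -/

section QuadraticForm

variable {ι : Type*} [Fintype ι]

theorem hasDerivWithinAt_dotProduct_mulVec (P : Matrix ι ι ℝ) {x : ℝ → ι → ℝ} {v : ι → ℝ}
    {s : Set ℝ} {t : ℝ} (hx : HasDerivWithinAt x v s t) :
    HasDerivWithinAt (fun u => x u ⬝ᵥ (P *ᵥ x u)) (v ⬝ᵥ (P *ᵥ x t) + x t ⬝ᵥ (P *ᵥ v)) s t := by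
  have hi := hasDerivWithinAt_pi.1 hx
  have h1 := HasDerivWithinAt.fun_sum (u := Finset.univ) fun i _ => (hi i).fun_mul
    (HasDerivWithinAt.fun_sum (u := Finset.univ) fun j _ => (hi j).const_mul (P i j))
  rw [Finset.sum_add_distrib] at h1
  exact h1

theorem continuous_dotProduct_mulVec (P : Matrix ι ι ℝ) :
    Continuous fun x : ι → ℝ => x ⬝ᵥ (P *ᵥ x) := by fun_prop

theorem dotProduct_mulVec_smul_self (P : Matrix ι ι ℝ) (a : ℝ) (x : ι → ℝ) :
    (a • x) ⬝ᵥ (P *ᵥ (a • x)) = a ^ 2 * (x ⬝ᵥ (P *ᵥ x)) := by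
  rw [mulVec_smul, smul_dotProduct, dotProduct_smul, smul_eq_mul, smul_eq_mul]; ring

/-- A positive definite quadratic form is comparable to the squared norm. -/
theorem exists_bounds_of_posDef {P : Matrix ι ι ℝ} (hP : P.PosDef) :
    ∃ m M : ℝ, 0 < m ∧ 0 < M ∧ ∀ x : ι → ℝ,
      m * ‖x‖ ^ 2 ≤ x ⬝ᵥ (P *ᵥ x) ∧ x ⬝ᵥ (P *ᵥ x) ≤ M * ‖x‖ ^ 2 := by
  rcases (Metric.sphere (0 : ι → ℝ) 1).eq_empty_or_nonempty with he | hne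
  · refine ⟨1, 1, one_pos, one_pos, fun x => ?_⟩
    have hx : x = 0 := by
      by_contra hx
      have : ‖x‖⁻¹ • x ∈ Metric.sphere (0 : ι → ℝ) 1 := by
        simp [norm_smul, hx]
      rw [he] at this
      exact this
    simp [hx]
  · have hcont := (continuous_dotProduct_mulVec P).continuousOn (s := Metric.sphere (0 : ι → ℝ) 1)
    obtain ⟨y, hy, hmin⟩ := (isCompact_sphere (0 : ι → ℝ) 1).exists_isMinOn hne hcont
    obtain ⟨z, hz, hmax⟩ := (isCompact_sphere (0 : ι → ℝ) 1).exists_isMaxOn hne hcont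
    have hpos : ∀ x : ι → ℝ, x ≠ 0 → 0 < x ⬝ᵥ (P *ᵥ x) := fun x hx => by
      simpa using hP.dotProduct_mulVec_pos hx
    have hne0 : ∀ x ∈ Metric.sphere (0 : ι → ℝ) 1, x ≠ 0 := by
      rintro x hx rfl
      simp at hx
    refine ⟨_, _, hpos y (hne0 y hy), hpos z (hne0 z hz), fun x => ?_⟩
    by_cases hx : x = 0
    · simp [hx]
    have hxn : ‖x‖ ≠ 0 := norm_ne_zero_iff.2 hx
    have hu : ‖x‖⁻¹ • x ∈ Metric.sphere (0 : ι → ℝ) 1 := by simp [norm_smul, hx]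
    have hx' : x ⬝ᵥ (P *ᵥ x) = ((‖x‖⁻¹ • x) ⬝ᵥ (P *ᵥ (‖x‖⁻¹ • x))) * ‖x‖ ^ 2 := by
      rw [dotProduct_mulVec_smul_self]
      field_simp
    rw [hx']
    exact ⟨mul_le_mul_of_nonneg_right (hmin hu) (by positivity),
      mul_le_mul_of_nonneg_right (hmax hu) (by positivity)⟩

end QuadraticForm

/-! ### Lyapunov decay along flows and resets -/

namespace ResetSystem

variable {n : ℕ} (S : ResetSystem n)

/-- Written as a shift along B₀, the reset can be combined with PB₀ = C₀ᵀ. -/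
theorem Arho_mulVec (x : State n) :
    S.Arho *ᵥ x = x + ((S.γ - 1) * x (Sum.inl 0)) • fun i => B0 n i 0 := by
  ext i
  rcases i with i | i
  · obtain rfl := Subsingleton.elim i 0
    simp [Arho, B0, scalar, mulVec, dotProduct]
    ring
  · simp [Arho, B0, mulVec, dotProduct, one_apply]

theorem Arho_mulVec_inl (x : State n) : (S.Arho *ᵥ x) (Sum.inl 0) = S.γ * x (Sum.inl 0) := by
  rw [Arho_mulVec]
  simp [B0]
  ring

theorem mem_resetSurface_zero {x : State n} (hx : x ∈ S.resetSurface 0) :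
    (S.Ce 0 ⬝ᵥ fun j => x (Sum.inr j)) = 0 ∧ S.γ ≠ 1 ∧ x (Sum.inl 0) ≠ 0 := by
  obtain ⟨h1, h2⟩ := hx
  refine ⟨?_, fun h => h2 ?_, fun h => h2 ?_⟩
  · have := congrFun h1 0
    simpa [CeBar, mulVec, dotProduct] using this
  · rw [sub_mulVec, one_mulVec, Arho_mulVec, h]
    simp
  · rw [sub_mulVec, one_mulVec, Arho_mulVec, h]
    simp

theorem isSolution_zero (t₀ : ℝ) : S.IsSolution 0 t₀ ⊤ (fun _ => 0) where
  left_continuous _ _ _ := continuousWithinAt_const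
  flow t _ _ _ := by simpa using hasDerivWithinAt_const t (Set.Ici t) (0 : State n)
  jump t _ _ _ := by simp

variable {S}

/-- At a reset, the quadratic form changes by `ϱ (γ² - 1) x_r²`. -/
theorem dotProduct_mulVec_Arho {ϱ β : ℝ} {P : Matrix (Fin 1 ⊕ Fin n) (Fin 1 ⊕ Fin n) ℝ}
    (hP : P.PosDef) (hPB : P *ᵥ (fun i => B0 n i 0) = S.C0 ϱ β 0) {x : State n}
    (hx : (S.Ce 0 ⬝ᵥ fun j => x (Sum.inr j)) = 0) :
    (S.Arho *ᵥ x) ⬝ᵥ (P *ᵥ (S.Arho *ᵥ x))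
      = x ⬝ᵥ (P *ᵥ x) + ϱ * (S.γ ^ 2 - 1) * x (Sum.inl 0) ^ 2 := by
  have hsymm : ∀ y : State n, (fun i => B0 n i 0) ⬝ᵥ (P *ᵥ y) = S.C0 ϱ β 0 ⬝ᵥ y := by
    intro y
    have hPt : Pᵀ = P := hP.isHermitian
    rw [dotProduct_mulVec, ← mulVec_transpose, hPt, hPB]
  have h1 : S.C0 ϱ β 0 ⬝ᵥ x = ϱ * x (Sum.inl 0) := by
    have h2 : S.C0 ϱ β 0 ⬝ᵥ x
        = ϱ * x (Sum.inl 0) + β * (S.Ce 0 ⬝ᵥ fun j => x (Sum.inr j)) := by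
      simp [C0, scalar, dotProduct, Finset.mul_sum, mul_assoc]
    rw [h2, hx, mul_zero, add_zero]
  have h3 : S.C0 ϱ β 0 ⬝ᵥ (fun i => B0 n i 0) = ϱ := by
    simp [C0, scalar, B0, dotProduct]
  rw [Arho_mulVec, mulVec_add, mulVec_smul, hPB, add_dotProduct, dotProduct_add, dotProduct_add,
    smul_dotProduct, smul_dotProduct, hsymm, dotProduct_smul, dotProduct_smul, h1,
    dotProduct_comm x (S.C0 ϱ β 0), h1, dotProduct_comm _ (S.C0 ϱ β 0), h3]
  simp only [smul_eq_mul]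
  ring

/-- With after-reset value `γ = -1`, a reset is followed by an interval without resets. -/
theorem IsSolution.eventually_notMem_resetSurface {t₀ : ℝ} {T : EReal} {x : ℝ → State n}
    (hx : S.IsSolution 0 t₀ T x) (hγ : S.γ = -1) {t b : ℝ} (ht : t₀ ≤ t) (htb : t < b)
    (hb : (b : EReal) < T) (hmem : x t ∈ S.resetSurface 0) :
    ∃ u, t < u ∧ u ≤ b ∧ ∀ s, t < s → s < u → x s ∉ S.resetSurface 0 := by
  have htT : (t : EReal) < T := (EReal.coe_lt_coe_iff.2 htb).trans hb
  have hx0 := (S.mem_resetSurface_zero hmem).2.2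
  have hjump : ∀ s, t₀ ≤ s → (s : EReal) < T → x s ∈ S.resetSurface 0 →
      Tendsto (fun s => x s (Sum.inl 0)) (𝓝[>] s) (𝓝 (-x s (Sum.inl 0))) := by
    intro s h1 h2 h3
    have h4 := tendsto_pi_nhds.1 (hx.jump s h1 h2 h3) (Sum.inl 0)
    rwa [Arho_mulVec_inl, hγ, neg_one_mul] at h4
  set y := -x t (Sum.inl 0)
  have hy : 0 < |y| := abs_pos.2 (neg_ne_zero.2 hx0)
  have hev : ∀ᶠ s in 𝓝[>] t, |x s (Sum.inl 0) - y| < |y| / 2 :=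
    (hjump t ht htT hmem).eventually (Metric.ball_mem_nhds y (half_pos hy))
  obtain ⟨u, hu, hu'⟩ := (mem_nhdsGT_iff_exists_Ioo_subset' htb).1
    (hev.and (Ioo_mem_nhdsGT htb))
  -- On (t, u) the reset state stays within |y|/2 of y. A second reset at s would put the right
  -- limit -x_r(s) within |y|/2 of y as well; adding the two estimates gives 2|y| < |y|.
  refine ⟨min u b, lt_min hu htb, min_le_right _ _, fun s hs hsu hsmem => ?_⟩
  have hsu' : s < u := hsu.trans_le (min_le_left _ _)
  have hsb : s < b := hsu.trans_le (min_le_right _ _)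
  have h1 : |x s (Sum.inl 0) - y| < |y| / 2 := (hu' ⟨hs, hsu'⟩ : _).1
  have h2 : |-x s (Sum.inl 0) - y| ≤ |y| / 2 := by
    have h3 := ((hjump s (ht.trans hs.le) ((EReal.coe_lt_coe_iff.2 hsb).trans hb) hsmem).sub_const
      y).abs
    refine le_of_tendsto h3 ?_
    filter_upwards [Ioo_mem_nhdsGT hsu'] with v hv
    exact ((hu' ⟨hs.trans hv.1, hv.2⟩ : _).1).le
  have h4 : |(x s (Sum.inl 0) - y) + (-x s (Sum.inl 0) - y)| < |y| :=
    (abs_add_le _ _).trans_lt (by linarith)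
  rw [show (x s (Sum.inl 0) - y) + (-x s (Sum.inl 0) - y) = -(2 * y) by ring, abs_neg, abs_mul,
    abs_two] at h4
  linarith

/-- Exponential decay of the Lyapunov function along solutions. -/
theorem IsSolution.exp_mul_dotProduct_mulVec_le {ϱ β a : ℝ}
    {P : Matrix (Fin 1 ⊕ Fin n) (Fin 1 ⊕ Fin n) ℝ}
    (hϱ : 0 < ϱ) (hγ : -1 ≤ S.γ ∧ S.γ ≤ 1) (hP : P.PosDef)
    (hPB : P *ᵥ (fun i => B0 n i 0) = S.C0 ϱ β 0)
    (hPA : ∀ x, x ⬝ᵥ (P *ᵥ (S.Abar *ᵥ x)) ≤ -a * (x ⬝ᵥ (P *ᵥ x)))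
    {t₀ : ℝ} {T : EReal} {x : ℝ → State n} (hx : S.IsSolution 0 t₀ T x) {b : ℝ} (hb : t₀ ≤ b)
    (hbT : (b : EReal) < T) :
    Real.exp (2 * a * b) * (x b ⬝ᵥ (P *ᵥ x b))
      ≤ Real.exp (2 * a * t₀) * (x t₀ ⬝ᵥ (P *ᵥ x t₀)) := by
  set V : State n → ℝ := fun y => y ⬝ᵥ (P *ᵥ y)
  have hV : Continuous V := continuous_dotProduct_mulVec P
  set g : ℝ → ℝ := fun t => Real.exp (2 * a * t) * V (x t)
  have hT : ∀ t, t ≤ b → (t : EReal) < T := fun t ht => (EReal.coe_le_coe_iff.2 ht).trans_lt hbT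
  have hexp : Continuous fun t : ℝ => Real.exp (2 * a * t) := by fun_prop
  have hleft : ∀ t, t₀ < t → t ≤ b → ContinuousWithinAt g (Set.Iic t) t := fun t h1 h2 =>
    hexp.continuousWithinAt.mul
      (hV.continuousAt.comp_continuousWithinAt (hx.left_continuous t h1 (hT t h2)))
  have hflow : ∀ t, t₀ ≤ t → t ≤ b → x t ∉ S.resetSurface 0 →
      ∃ d ≤ 0, HasDerivWithinAt g d (Set.Ici t) t := by
    intro t h1 h2 h3
    have h4 := hx.flow t h1 (hT t h2) h3
    simp only [Pi.zero_apply, mulVec_zero, add_zero] at h4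
    have h5 := hasDerivWithinAt_dotProduct_mulVec P h4
    have h6 : HasDerivWithinAt (fun t : ℝ => Real.exp (2 * a * t))
        (Real.exp (2 * a * t) * (2 * a * 1)) (Set.Ici t) t :=
      (((hasDerivAt_id t).const_mul (2 * a)).exp).hasDerivWithinAt
    refine ⟨_, ?_, h6.fun_mul h5⟩
    have h7 := hPA (x t)
    have h8 : (S.Abar *ᵥ x t) ⬝ᵥ (P *ᵥ x t) = x t ⬝ᵥ (P *ᵥ (S.Abar *ᵥ x t)) := by
      have hPt : Pᵀ = P := hP.isHermitian
      rw [dotProduct_mulVec, ← mulVec_transpose, hPt, dotProduct_comm]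
    rw [h8]
    have h9 := Real.exp_pos (2 * a * t)
    nlinarith
  have hjump : ∀ t, t₀ ≤ t → t ≤ b → x t ∈ S.resetSurface 0 →
      Tendsto g (𝓝[>] t) (𝓝 (Real.exp (2 * a * t)
        * (V (x t) + ϱ * (S.γ ^ 2 - 1) * x t (Sum.inl 0) ^ 2))) := by
    intro t h1 h2 h3
    have h4 := (hV.tendsto _).comp (hx.jump t h1 (hT t h2) h3)
    rw [show V (S.Arho *ᵥ x t) = _ from
      dotProduct_mulVec_Arho hP hPB (S.mem_resetSurface_zero h3).1] at h4
    exact (hexp.continuousWithinAt.tendsto).mul h4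
  refine le_of_right_deriv_nonpos_or_eventually_le hb hleft fun t h1 h2 => ?_
  by_cases h3 : x t ∈ S.resetSurface 0
  · right
    have hx0 := (S.mem_resetSurface_zero h3).2.2
    have hγ1 := (S.mem_resetSurface_zero h3).2.1
    have hlim := hjump t h1 h2.le h3
    -- For γ = -1 the right limit of g at t equals g(t), so there is no strict drop to absorb later
    -- growth. Instead g is monotone on the reset-free interval after t, and g(s) ≤ g(v) is passed
    -- to the limit v → t. For γ > -1 the drop is strict.
    rcases hγ.1.eq_or_lt with h4 | h4
    · obtain ⟨u, htu, hub, hu⟩ := hx.eventually_notMem_resetSurface h4.symm h1 h2 hbT h3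
      rw [← h4] at hlim
      have hlim' : Tendsto g (𝓝[>] t) (𝓝 (g t)) := by
        convert hlim using 2
        simp only [g]
        ring
      filter_upwards [Ioo_mem_nhdsGT htu] with s hs
      refine ge_of_tendsto hlim' ?_
      filter_upwards [Ioo_mem_nhdsGT hs.1] with v hv
      have hsb : s ≤ b := hs.2.le.trans hub
      refine le_of_right_deriv_nonpos_or_eventually_le hv.2.le
        (fun r h5 h6 => hleft r ((h1.trans_lt hv.1).trans h5) (h6.trans hsb))
        (fun r h5 h6 => Or.inl (hflow r (h1.trans (hv.1.le.trans h5)) (h6.le.trans hsb)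
          (hu r (hv.1.trans_le h5) (h6.trans hs.2))))
    · have h5 : S.γ ^ 2 - 1 < 0 := by
        have : S.γ < 1 := lt_of_le_of_ne hγ.2 hγ1
        nlinarith
      have h6 : ϱ * (S.γ ^ 2 - 1) * x t (Sum.inl 0) ^ 2 < 0 :=
        mul_neg_of_neg_of_pos (mul_neg_of_pos_of_neg hϱ h5) (by positivity)
      have h7 : Real.exp (2 * a * t) * (V (x t) + ϱ * (S.γ ^ 2 - 1) * x t (Sum.inl 0) ^ 2)
          < g t := mul_lt_mul_of_pos_left (by linarith) (Real.exp_pos _)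
      exact (hlim.eventually_lt_const h7).mono fun s hs => hs.le
  · exact Or.inl (hflow t h1 h2.le h3)

/-- Solutions with zero input decay exponentially, uniformly in the initial time. -/
theorem exists_exponential_bound {ϱ β : ℝ} (hϱ : 0 < ϱ)
    (hspr : IsStrictlyPositiveReal (S.Hbeta ϱ β)) (hB : IsControllable S.Abar (B0 n))
    (hC : IsObservable S.Abar (S.C0 ϱ β)) (hγ : -1 ≤ S.γ ∧ S.γ ≤ 1) :
    ∃ K a : ℝ, 0 < K ∧ 0 < a ∧ ∀ (t₀ : ℝ) (T : EReal) (x : ℝ → State n), S.IsSolution 0 t₀ T x →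
      ∀ t : ℝ, t₀ ≤ t → (t : EReal) < T → ‖x t‖ ≤ K * Real.exp (-a * (t - t₀)) * ‖x t₀‖ := by
  obtain ⟨P, a, hP, ha, hPB, hPA⟩ := hspr.exists_posDef hB hC
  obtain ⟨m, M, hm, hM, hmM⟩ := exists_bounds_of_posDef hP
  -- From m‖x‖² ≤ V ≤ M‖x‖²; the square root also halves the rate 2a of V.
  refine ⟨√(M / m), a, by positivity, ha, fun t₀ T x hx t ht htT => ?_⟩
  have h1 := hx.exp_mul_dotProduct_mulVec_le hϱ hγ hP hPB hPA ht htT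
  refine le_of_sq_le_sq ?_ (by positivity)
  rw [mul_pow, mul_pow, Real.sq_sqrt (by positivity), ← Real.exp_nat_mul]
  have h2 : m * ‖x t‖ ^ 2 * Real.exp (2 * a * t) ≤ M * ‖x t₀‖ ^ 2 * Real.exp (2 * a * t₀) := by
    have h3 := mul_le_mul_of_nonneg_left (hmM (x t)).1 (Real.exp_pos (2 * a * t)).le
    have h4 := mul_le_mul_of_nonneg_left (hmM (x t₀)).2 (Real.exp_pos (2 * a * t₀)).le
    linarith
  have h5 : Real.exp ((2 : ℕ) * (-a * (t - t₀))) = Real.exp (2 * a * t₀) / Real.exp (2 * a * t) := by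
    rw [← Real.exp_sub]
    congr 1
    push_cast
    ring
  rw [h5]
  have h6 := Real.exp_pos (2 * a * t)
  rw [show M / m * (Real.exp (2 * a * t₀) / Real.exp (2 * a * t)) * ‖x t₀‖ ^ 2
    = M * ‖x t₀‖ ^ 2 * Real.exp (2 * a * t₀) / (m * Real.exp (2 * a * t)) by field_simp,
    le_div_iff₀ (by positivity)]
  linarith

end ResetSystem

end ResetControl

end

theorem theorem1 (n : ℕ) (S : ResetControl.ResetSystem n)
    (h : ∃ ϱ β : ℝ, 0 < ϱ ∧
      ResetControl.IsStrictlyPositiveReal (S.Hbeta ϱ β) ∧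
      ResetControl.IsControllable S.Abar (ResetControl.ResetSystem.B0 n) ∧
      ResetControl.IsObservable S.Abar (S.C0 ϱ β))
    (hγ : -1 ≤ S.γ ∧ S.γ ≤ 1) :
    S.IsGloballyUniformlyAsymptoticallyStable := by
  obtain ⟨ϱ, β, hϱ, hspr, hB, hC⟩ := h
  obtain ⟨K, a, hK, ha, hdecay⟩ :=
    ResetControl.ResetSystem.exists_exponential_bound hϱ hspr hB hC hγ
  have hbound : ∀ (t₀ : ℝ) (T : EReal) (x : ℝ → ResetControl.State n), S.IsSolution 0 t₀ T x →
      ∀ t : ℝ, t₀ ≤ t → (t : EReal) < T → ‖x t‖ ≤ K * ‖x t₀‖ := by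
    intro t₀ T x hx t ht htT
    refine (hdecay t₀ T x hx t ht htT).trans (mul_le_mul_of_nonneg_right ?_ (norm_nonneg _))
    refine mul_le_of_le_one_right hK.le (Real.exp_le_one_iff.2 ?_)
    nlinarith
  refine ⟨S.isSolution_zero, fun ε hε => ⟨ε / K, by positivity, ?_⟩,
    fun r hr => ⟨K * r, by positivity, ?_⟩, fun r hr ε hε => ?_⟩
  · intro t₀ T x hx h0 t ht htT
    refine (hbound t₀ T x hx t ht htT).trans_lt ?_
    rwa [lt_div_iff₀ hK, mul_comm] at h0
  · intro t₀ T x hx h0 t ht htT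
    exact (hbound t₀ T x hx t ht htT).trans_lt (mul_lt_mul_of_pos_left h0 hK)
  · have hlim : Tendsto (fun τ : ℝ => K * Real.exp (-a * τ) * r) atTop (𝓝 (K * 0 * r)) := by
      refine (Tendsto.const_mul K ?_).mul_const r
      refine Real.tendsto_exp_atBot.comp ?_
      exact tendsto_id.const_mul_atTop_of_neg (neg_lt_zero.2 ha)
    rw [mul_zero, zero_mul] at hlim
    obtain ⟨τ, hτ, hτ0⟩ := ((hlim.eventually_lt_const hε).and (eventually_gt_atTop 0)).exists
    refine ⟨τ, hτ0, fun t₀ T x hx h0 t ht htT => ?_⟩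
    refine (hdecay t₀ T x hx t (by linarith) htT).trans_lt (lt_of_le_of_lt ?_ hτ)
    have h1 : Real.exp (-a * (t - t₀)) ≤ Real.exp (-a * τ) :=
      Real.exp_le_exp.2 (by nlinarith)
    exact mul_le_mul (mul_le_mul_of_nonneg_left h1 hK.le) h0.le (norm_nonneg _) (by positivity)
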